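/- Let $\phi\colon\mathbb R\to\mathbb R$ satisfy: (i) $\phi$ is continuous; (ii) $\phi(a)=O(|a|+1)$, i.e. there is $K$ with $|\phi(a)|\le K(|a|+1)$ for all $a\in\mathbb R$; (iii) the even part $\phi_e(a)=\tfrac12(\phi(a)+\phi(-a))$ is not constant; (iv) there is $a\in\mathbb R$ with $\phi(a)^2+\phi(-a)^2\ne 2\phi(0)^2$ (i.e. $\phi^2$ is not an odd function plus a constant). For example, ReLU satisfies (i)–(iv). Fix an input dimension $D\ge 1$ and a number $L\ge 1$ of hidden layers. For every width $M\ge 1$ consider the network $f_\theta\colon\mathbb R^{D}\to\mathbb R$, $$f_\theta(\mathbf x)=\tfrac1{\sqrt M}\mathbf W_{L+1}\phi(\mathbf z_L)+b_{L+1},\qquad \mathbf z_l=\tfrac1{\sqrt M}\mathbf W_l\,\phi(\mathbf z_{l-1})+\mathbf b_l\ (2\le l\le L),\qquad \mathbf z_1=\tfrac1{\sqrt{D}}\mathbf W_1\mathbf x+\mathbf b_1,$$ where $\mathbf z_l\in\mathbb R^M$, $\phi$ acts entrywise, and $\theta$ collects all weights and biases. Let $P=P_M=\mathcal N(\mathbf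 0,\mathbf I)$ be the prior on $\theta$ and let $\mathcal Q=\mathcal Q_M$ be the mean-field family of all Gaussian distributions on $\theta$ with diagonal covariance and strictly positive variances. For data $(\mathbf x_n,y_n)$, $n=1,\dots,N$, with $y_n\in\mathbb R$ and the homoscedastic Gaussian likelihood $y_n\sim\mathcal N(f_\theta(\mathbf x_n),\sigma^2)$ (independent over $n$), put $$\mathrm{ELBO}(Q)=\mathbb E_{\theta\sim Q}\Big[\sum_{n=1}^N\log\mathcal N\big(y_n;f_\theta(\mathbf x_n),\sigma^2\big)\Big]-\mathrm{KL}(Q,P),$$ and call $Q^*\in\mathcal Q$ an optimal variational posterior if it maximizes $\mathrm{ELBO}$ over $\mathcal Q$. Then there exist a dataset of two points $(\mathbf x,y),(\mathbf x',y')\in\mathbb R^{D}\times\mathbb R$, a noise variance $\sigma^2>0$ and a constant $c>0$, none of which depends on $M$, such that for every width $M\ge1$ an optimal variational posterior exists, and every optimal variational posterior $Q^*\in\mathcal Q_M$ satisfies $$\big|\mathbb E_{Q^*}[f_\theta(\mathbf x)]-\mathbb E_{Q^*}[f_\theta(\mathbf x')]\big|\ge c .$$ In particular the variational posterior mean does not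 revert to the prior mean as $M\to\infty$: for every $M\ge1$ and every optimal $Q^*\in\mathcal Q_M$, $$\max\big\{|\mathbb E_{Q^*}[f_\theta(\mathbf x)]-\mathbb E_{P}[f_\theta(\mathbf x)]|,\ |\mathbb E_{Q^*}[f_\theta(\mathbf x')]-\mathbb E_{P}[f_\theta(\mathbf x')]|\big\}\ge \tfrac c2 .$$ -/

import Mathlib

open MeasureTheory ProbabilityTheory
open scoped NNReal

/-- Labels of the scalar parameters of a fully connected feed-forward network with input dimension
`Din`, scalar output, and `H + 1` hidden layers with `M` neurons each. The hidden layers are numbered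
`0, …, H`; `weightHid l i j` is the weight from neuron `j` of hidden layer `l` to neuron `i` of hidden
layer `l + 1`, and `biasHid l i` is the bias of neuron `i` of hidden layer `l + 1`. -/
inductive NNParam (Din M H : ℕ) : Type
  | weightIn (i : Fin M) (j : Fin Din)
  | biasIn (i : Fin M)
  | weightHid (l : Fin H) (i j : Fin M)
  | biasHid (l : Fin H) (i : Fin M)
  | weightOut (j : Fin M)
  | biasOut
  deriving DecidableEq, Fintype

noncomputable section

/-- The pre-activations of hidden layer `l` (layers numbered from `0` to `H`) at the input `x`. -/
def preact {Din M H : ℕ} (φ : ℝ → ℝ) (θ : NNParam Din M H → ℝ)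
    (x : EuclideanSpace ℝ (Fin Din)) : (l : ℕ) → l ≤ H → Fin M → ℝ
  | 0, _, i => 1 / √(Din : ℝ) * ∑ j, θ (.weightIn i j) * x j + θ (.biasIn i)
  | l + 1, h, i =>
      1 / √(M : ℝ) *
          ∑ j, θ (.weightHid ⟨l, h⟩ i j) * φ (preact φ θ x l (Nat.le_of_succ_le h) j)
        + θ (.biasHid ⟨l, h⟩ i)

/-- The network output `f_θ(x)`. -/
def network {Din M H : ℕ} (φ : ℝ → ℝ) (θ : NNParam Din M H → ℝ)
    (x : EuclideanSpace ℝ (Fin Din)) : ℝ :=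
  1 / √(M : ℝ) * ∑ j, θ (.weightOut j) * φ (preact φ θ x H le_rfl j) + θ .biasOut

/-- The factorized Gaussian distribution over the parameters with means `m` and variances `v`. -/
def factorizedGaussian {Din M H : ℕ} (m : NNParam Din M H → ℝ) (v : NNParam Din M H → ℝ≥0) :
    Measure (NNParam Din M H → ℝ) :=
  Measure.pi fun p => gaussianReal (m p) (v p)

/-- The prior: independent standard Gaussian parameters (weights and biases). -/
def nnPrior (Din M H : ℕ) : Measure (NNParam Din M H → ℝ) :=
  factorizedGaussian (fun _ => 0) (fun _ => 1)

/-- The mean-field variational family: all factorized Gaussians with positive variances. -/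
def meanFieldFamily (Din M H : ℕ) : Set (Measure (NNParam Din M H → ℝ)) :=
  {Q | ∃ (m : NNParam Din M H → ℝ) (v : NNParam Din M H → ℝ≥0),
    (∀ p, 0 < v p) ∧ Q = factorizedGaussian m v}

/-- The log-likelihood of the parameters `θ` for the data `(x n, y n)`, `n < N`, under the
homoscedastic Gaussian likelihood `y n ∼ N(f_θ(x n), s)`, independently over `n`; `s` is the noise
variance. -/
def logLikelihood {Din M H N : ℕ} (φ : ℝ → ℝ) (x : Fin N → EuclideanSpace ℝ (Fin Din))
    (y : Fin N → ℝ) (s : ℝ≥0) (θ : NNParam Din M H → ℝ) : ℝ :=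
  ∑ n, Real.log (gaussianPDFReal (network φ θ (x n)) s (y n))

/-- The evidence lower bound `E_Q[log-likelihood] - KL(Q, P)`. -/
def elbo {Din M H N : ℕ} (φ : ℝ → ℝ) (x : Fin N → EuclideanSpace ℝ (Fin Din))
    (y : Fin N → ℝ) (s : ℝ≥0) (Q : Measure (NNParam Din M H → ℝ)) : ℝ :=
  ∫ θ, logLikelihood φ x y s θ ∂Q - (InformationTheory.klDiv Q (nnPrior Din M H)).toReal

/-- `Q` is an optimal mean-field variational posterior: a maximizer of the evidence lower bound
over the mean-field family. -/
def IsOptimalMeanField {Din M H N : ℕ} (φ : ℝ → ℝ) (x : Fin N → EuclideanSpace ℝ (Fin Din))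
    (y : Fin N → ℝ) (s : ℝ≥0) (Q : Measure (NNParam Din M H → ℝ)) : Prop :=
  Q ∈ meanFieldFamily Din M H ∧ IsMaxOn (elbo φ x y s) (meanFieldFamily Din M H) Q

/-- The mean `E_Q[f_θ(x)]` of the predictive distribution at the input `x`. -/
def predictiveMean {Din M H : ℕ} (φ : ℝ → ℝ) (Q : Measure (NNParam Din M H → ℝ))
    (x : EuclideanSpace ℝ (Fin Din)) : ℝ :=
  ∫ θ, network φ θ x ∂Q

/-- The even part of a function. -/
def evenPart (φ : ℝ → ℝ) (a : ℝ) : ℝ := (φ a + φ (-a)) / 2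

end

/-! The argument exhibits a competitor in the variational family that fits well-chosen data at a
cost bounded in the width, and then makes the noise so small that an optimal posterior cannot afford
a flat mean.

The competitor for large `M` is the prior with every output weight moved by `a / √M`. Its divergence
from the prior is `a ^ 2 / 2` at every width (`sum_klGauss_outputShift`), and it adds to the prior
network `a` times the average activation of the last hidden layer (`network_outputShift_add`). Under
the prior that average concentrates, with mean squared error `O(1 / M)`, at a limit `g` depending on
the input (`exists_integral_sq_average_sub_le`), while the prior output has second moment bounded in
`M` (`exists_integral_sq_network_le`). With targets `a * g`, the expected squared loss is therefore
bounded for `M` large in terms of `a`, by a constant free of `a`, whereas the squared gap of the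
targets grows like `a ^ 2`. The finitely many remaining widths are handled by exact interpolation
with small variances (`exists_network_eq`, `exists_integral_sqLoss_le`). This gives a divergence
bound `B` uniform in `M` (`exists_uniform_fit`); a noise variance of order `Δ ^ 2 / (B + 1)`, for
the target gap `Δ`, then makes every optimal posterior fit well, and by Jensen its means at the two
inputs are separated.

Two inputs with different limits `g` are needed. Here `g` is the Gaussian mean of `φ` at a variance
obtained by iterating `v ↦ 1 + E φ(√v ξ) ^ 2`. A Gaussian mean that is constant on an interval of
variances forces a constant even part, by uniqueness of moment generating functions
(`evenPart_eq_of_gaussMean_eq`). Condition (iv) thus keeps an interval of variances alive through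
the layers, and condition (iii) separates two of them at the end (`exists_gaussMean_layerVar_ne`).

Concentration is by induction over layers: given the earlier layers, the neurons of a layer are
independent Gaussians of a common random variance. The unit bias variance keeps this variance at
least `1`, where Gaussian means are Lipschitz in the variance without any smoothness of `φ`. -/

/-! ### Gaussian means as functions of the variance: growth and Lipschitz bounds -/

section GaussianMean

/-- The Gaussian mean of `ψ` at variance `v`. -/
noncomputable def gaussMean (ψ : ℝ → ℝ) (v : ℝ) : ℝ := ∫ t, ψ (√v * t) ∂gaussianReal 0 1

lemma integrable_one_add_sq_pow (m : ℝ) (v : ℝ≥0) (k : ℕ) :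
    Integrable (fun t : ℝ => (1 + t ^ 2) ^ k) (gaussianReal m v) := by
  have h1 : MemLp (fun t : ℝ => 1 + |t|) ((2 * k : ℕ) : ENNReal) (gaussianReal m v) :=
    (memLp_const (1 : ℝ)).add (memLp_id_gaussianReal' _ (ENNReal.natCast_ne_top _)).abs
  have h2 := h1.integrable_norm_pow'
  refine h2.mono' (by fun_prop) (Filter.Eventually.of_forall fun t => ?_)
  rw [Real.norm_of_nonneg (by positivity), Real.norm_of_nonneg (by positivity), pow_mul]
  gcongr
  nlinarith [abs_nonneg t, sq_abs t]

lemma integrable_gaussianReal_of_growth {ψ : ℝ → ℝ} (hm : Measurable ψ) {K : ℝ} {k : ℕ}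
    (h : ∀ t, |ψ t| ≤ K * (1 + t ^ 2) ^ k) (m : ℝ) (v : ℝ≥0) :
    Integrable ψ (gaussianReal m v) :=
  ((integrable_one_add_sq_pow m v k).const_mul K).mono' hm.aestronglyMeasurable
    (Filter.Eventually.of_forall h)

/-- The moment `E (1 + ξ ^ 2) ^ 2` of a standard normal variable. -/
noncomputable def stdMoment : ℝ := ∫ t, (1 + t ^ 2) ^ 2 ∂gaussianReal 0 1

lemma stdMoment_nonneg : 0 ≤ stdMoment := integral_nonneg fun t => by positivity

lemma gaussMean_eq_integral {ψ : ℝ → ℝ} (hm : Measurable ψ) {v : ℝ} (hv : 0 ≤ v) :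
    gaussMean ψ v = ∫ t, ψ t ∂gaussianReal 0 v.toNNReal := by
  have h : (gaussianReal 0 1).map (fun t => √v * t) = gaussianReal 0 v.toNNReal := by
    rw [gaussianReal_map_const_mul]
    congr 1
    · simp
    · ext
      simp [Real.sq_sqrt hv, hv]
  rw [← h, integral_map (by fun_prop) hm.aestronglyMeasurable]
  rfl

lemma gaussMean_eq_integral_pdf {ψ : ℝ → ℝ} (hm : Measurable ψ) {v : ℝ} (hv : 0 < v) :
    gaussMean ψ v = ∫ t, gaussianPDFReal 0 v.toNNReal t * ψ t := by
  rw [gaussMean_eq_integral hm hv.le, integral_gaussianReal_eq_integral_smul (by simpa using hv)]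
  rfl

lemma one_add_mul_sq_le {v : ℝ} (hv : 0 ≤ v) (t : ℝ) :
    1 + (√v * t) ^ 2 ≤ (1 + v) * (1 + t ^ 2) := by
  rw [mul_pow, Real.sq_sqrt hv]
  nlinarith [sq_nonneg t]

lemma abs_gaussMean_le {ψ : ℝ → ℝ} {K : ℝ} (hK : 0 ≤ K)
    (h : ∀ t, |ψ t| ≤ K * (1 + t ^ 2)) {v : ℝ} (hv : 0 ≤ v) :
    |gaussMean ψ v| ≤ K * stdMoment * (1 + v) := by
  have : ‖gaussMean ψ v‖ ≤ ∫ t, K * (1 + v) * (1 + t ^ 2) ^ 2 ∂gaussianReal 0 1 := by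
    refine norm_integral_le_of_norm_le ((integrable_one_add_sq_pow 0 1 2).const_mul _)
      (Filter.Eventually.of_forall fun t => ?_)
    refine (h _).trans ?_
    rw [mul_assoc]
    refine mul_le_mul_of_nonneg_left ((one_add_mul_sq_le hv t).trans ?_) hK
    have : 0 ≤ t ^ 2 := sq_nonneg t
    gcongr
    nlinarith
  rw [integral_const_mul] at this
  calc |gaussMean ψ v| ≤ _ := this
    _ = _ := by rw [stdMoment]; ring

lemma gaussMean_sq_le {ψ : ℝ → ℝ} {K : ℝ}
    (h : ∀ t, |ψ t| ≤ K * (1 + t ^ 2)) {v : ℝ} (hv : 0 ≤ v) :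
    gaussMean (fun t => ψ t ^ 2) v ≤ K ^ 2 * stdMoment * (1 + v) ^ 2 := by
  have : ‖gaussMean (fun t => ψ t ^ 2) v‖
      ≤ ∫ t, K ^ 2 * (1 + v) ^ 2 * (1 + t ^ 2) ^ 2 ∂gaussianReal 0 1 := by
    refine norm_integral_le_of_norm_le ((integrable_one_add_sq_pow 0 1 2).const_mul _)
      (Filter.Eventually.of_forall fun t => ?_)
    have h1 := h (√v * t)
    have h2 := one_add_mul_sq_le hv t
    have hK : 0 ≤ K := by
      have := (abs_nonneg _).trans (h 0)
      simpa using this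
    have h3 : |ψ (√v * t)| ≤ K * ((1 + v) * (1 + t ^ 2)) :=
      h1.trans (mul_le_mul_of_nonneg_left h2 hK)
    rw [norm_pow, Real.norm_eq_abs]
    calc |ψ (√v * t)| ^ 2 ≤ (K * ((1 + v) * (1 + t ^ 2))) ^ 2 := by gcongr
      _ = _ := by ring
  rw [integral_const_mul] at this
  calc gaussMean (fun t => ψ t ^ 2) v ≤ _ := (le_abs_self _).trans this
    _ = _ := by rw [stdMoment]; ring

/-- The two densities have ratio `r * exp (-u)` with `1 ≤ r ≤ 1 + (v - w) / w` and `0 ≤ u ≤ (v - w)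
/ w * (t ^ 2 / v)`. Comparing densities puts all dependence on the variance into the Gaussian, so
that no regularity of the integrand is needed afterwards. -/
lemma abs_gaussianPDFReal_sub_le {v w : ℝ} (hw : 1 ≤ w) (hwv : w ≤ v) (t : ℝ) :
    |gaussianPDFReal 0 v.toNNReal t - gaussianPDFReal 0 w.toNNReal t|
      ≤ (v - w) / w * (gaussianPDFReal 0 v.toNNReal t * (1 + t ^ 2 / v)) := by
  have hw0 : 0 < w := by linarith
  have hv0 : 0 < v := by linarith
  set r : ℝ := √(v / w) with hr
  set u : ℝ := t ^ 2 * (v - w) / (2 * v * w) with hu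
  have hu0 : 0 ≤ u := by
    have : 0 ≤ v - w := by linarith
    positivity
  have hr1 : 1 ≤ r := by
    rw [hr, Real.one_le_sqrt, one_le_div hw0]; exact hwv
  have hr2 : r ≤ 1 + (v - w) / w := by
    have h1 : r ^ 2 = 1 + (v - w) / w := by
      rw [hr, Real.sq_sqrt (by positivity)]; field_simp; ring
    nlinarith
  have hp : gaussianPDFReal 0 w.toNNReal t
      = gaussianPDFReal 0 v.toNNReal t * (r * Real.exp (-u)) := by
    simp only [gaussianPDFReal, Real.coe_toNNReal _ hw0.le, Real.coe_toNNReal _ hv0.le, sub_zero]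
    have h1 : (√(2 * Real.pi * w))⁻¹ = (√(2 * Real.pi * v))⁻¹ * r := by
      rw [hr, Real.sqrt_div hv0.le, Real.sqrt_mul (x := 2 * Real.pi) (by positivity),
        Real.sqrt_mul (x := 2 * Real.pi) (by positivity)]
      have := Real.sqrt_pos.2 hv0
      have := Real.sqrt_pos.2 hw0
      field_simp
    have h2 : Real.exp (-t ^ 2 / (2 * w)) = Real.exp (-t ^ 2 / (2 * v)) * Real.exp (-u) := by
      rw [← Real.exp_add]
      congr 1
      rw [hu]
      field_simp
      ring
    rw [h1, h2]; ring
  have hpos : 0 ≤ gaussianPDFReal 0 v.toNNReal t := gaussianPDFReal_nonneg _ _ _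
  rw [hp, show ∀ a b : ℝ, a - a * b = a * (1 - b) by intros; ring, abs_mul, abs_of_nonneg hpos]
  have he : 1 - u ≤ Real.exp (-u) := by linarith [Real.add_one_le_exp (-u)]
  have he1 : Real.exp (-u) ≤ 1 := Real.exp_le_one_iff.2 (by linarith)
  have hep := Real.exp_pos (-u)
  have hvw : 0 ≤ (v - w) / w := div_nonneg (by linarith) hw0.le
  have hu' : u ≤ (v - w) / w * (t ^ 2 / v) := by
    have : (v - w) / w * (t ^ 2 / v) = 2 * u := by rw [hu]; field_simp
    linarith
  have hmain : |1 - r * Real.exp (-u)| ≤ (v - w) / w * (1 + t ^ 2 / v) := by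
    have h3 : 0 ≤ (v - w) / w * (t ^ 2 / v) := by positivity
    rw [abs_le]
    constructor <;> nlinarith
  calc _ ≤ gaussianPDFReal 0 v.toNNReal t * ((v - w) / w * (1 + t ^ 2 / v)) := by gcongr
    _ = _ := by ring

/-- For `v ≥ 2 * w` the growth of Gaussian means suffices, since `v - w` then dominates `v`, `w` and
`1`. For `v < 2 * w` the densities are compared, and `(1 + v) / w` is bounded because `w ≥ 1`. -/
lemma abs_gaussMean_sub_le {ψ : ℝ → ℝ} (hm : Measurable ψ) {K : ℝ} (hK : 0 ≤ K)
    (h : ∀ t, |ψ t| ≤ K * (1 + t ^ 2)) {v w : ℝ} (hw : 1 ≤ w) (hwv : w ≤ v) :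
    |gaussMean ψ v - gaussMean ψ w| ≤ 8 * (K * stdMoment) * (v - w) := by
  have hw0 : 0 < w := by linarith
  have hv0 : 0 < v := by linarith
  have hS := stdMoment_nonneg
  have hKS : 0 ≤ K * stdMoment := mul_nonneg hK hS
  rcases le_or_gt (2 * w) v with h2 | h2
  · have h3 := abs_gaussMean_le hK h hv0.le
    have h4 := abs_gaussMean_le hK h hw0.le
    calc |gaussMean ψ v - gaussMean ψ w| ≤ |gaussMean ψ v| + |gaussMean ψ w| := abs_sub _ _
      _ ≤ K * stdMoment * (1 + v) + K * stdMoment * (1 + w) := add_le_add h3 h4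
      _ = K * stdMoment * (2 + v + w) := by ring
      _ ≤ K * stdMoment * (8 * (v - w)) := by gcongr; linarith
      _ = _ := by ring
  · have hint : ∀ {v : ℝ}, 0 < v →
        Integrable (fun t => gaussianPDFReal 0 v.toNNReal t * ψ t) := by
      intro v hv
      have := integrable_gaussianReal_of_growth (k := 1) hm (by simpa using h) 0 v.toNNReal
      rw [gaussianReal_of_var_ne_zero _ (by simpa using hv),
        integrable_withDensity_iff_integrable_smul₀' (by fun_prop)
          (ae_of_all _ fun _ => gaussianPDF_lt_top)] at this
      simpa [toReal_gaussianPDF] using this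
    have hb : |gaussMean ψ v - gaussMean ψ w| ≤ ∫ t, (v - w) / w *
        (gaussianPDFReal 0 v.toNNReal t * ((1 + t ^ 2 / v) * (K * (1 + t ^ 2)))) := by
      rw [gaussMean_eq_integral_pdf hm hv0, gaussMean_eq_integral_pdf hm hw0,
        ← integral_sub (hint hv0) (hint hw0), ← Real.norm_eq_abs]
      refine norm_integral_le_of_norm_le ?_ (Filter.Eventually.of_forall fun t => ?_)
      · have : Integrable (fun t : ℝ => (1 + t ^ 2 / v) * (K * (1 + t ^ 2)))
            (gaussianReal 0 v.toNNReal) := by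
          refine integrable_gaussianReal_of_growth (by fun_prop) (K := (1 + 1 / v) * K) (k := 2)
            (fun t => ?_) _ _
          rw [abs_of_nonneg (by positivity)]
          have : 1 + t ^ 2 / v ≤ (1 + 1 / v) * (1 + t ^ 2) := by
            have : 0 ≤ 1 / v := by positivity
            have h5 : t ^ 2 / v = 1 / v * t ^ 2 := by ring
            rw [h5]; nlinarith [sq_nonneg t]
          calc (1 + t ^ 2 / v) * (K * (1 + t ^ 2))
              ≤ ((1 + 1 / v) * (1 + t ^ 2)) * (K * (1 + t ^ 2)) := by gcongr
            _ = _ := by ring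
        rw [gaussianReal_of_var_ne_zero _ (by simpa using hv0),
          integrable_withDensity_iff_integrable_smul₀' (by fun_prop)
          (ae_of_all _ fun _ => gaussianPDF_lt_top)] at this
        simpa [toReal_gaussianPDF] using this.const_mul ((v - w) / w)
      · rw [← sub_mul, norm_mul, Real.norm_eq_abs, Real.norm_eq_abs]
        calc _ ≤ ((v - w) / w * (gaussianPDFReal 0 v.toNNReal t * (1 + t ^ 2 / v)))
              * (K * (1 + t ^ 2)) := by
              gcongr
              · exact (abs_nonneg _).trans (abs_gaussianPDFReal_sub_le hw hwv t)
              · exact abs_gaussianPDFReal_sub_le hw hwv t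
              · exact h t
          _ = _ := by ring
    refine hb.trans ?_
    rw [integral_const_mul,
      ← gaussMean_eq_integral_pdf (ψ := fun t => (1 + t ^ 2 / v) * (K * (1 + t ^ 2)))
        (by fun_prop) hv0]
    have hc : gaussMean (fun t => (1 + t ^ 2 / v) * (K * (1 + t ^ 2))) v
        ≤ (K * (1 + v)) * stdMoment := by
      rw [stdMoment, ← integral_const_mul, gaussMean]
      refine integral_mono_of_nonneg (Filter.Eventually.of_forall fun t => by positivity)
        ((integrable_one_add_sq_pow 0 1 2).const_mul _) (Filter.Eventually.of_forall fun t => ?_)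
      have h6 := one_add_mul_sq_le hv0.le t
      have h7 : (√v * t) ^ 2 / v = t ^ 2 := by
        rw [mul_pow, Real.sq_sqrt hv0.le]; field_simp
      simp only [h7]
      calc (1 + t ^ 2) * (K * (1 + (√v * t) ^ 2))
          ≤ (1 + t ^ 2) * (K * ((1 + v) * (1 + t ^ 2))) := by gcongr
        _ = _ := by ring
    have hvw : 0 ≤ (v - w) / w := div_nonneg (by linarith) hw0.le
    calc _ ≤ (v - w) / w * ((K * (1 + v)) * stdMoment) := by gcongr
      _ = (K * stdMoment * (v - w)) * ((1 + v) / w) := by ring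
      _ ≤ (K * stdMoment * (v - w)) * 8 := by
          have : 0 ≤ v - w := by linarith
          gcongr
          rw [div_le_iff₀ hw0]; linarith
      _ = _ := by ring

/-- Gaussian means are Lipschitz in the variance, away from zero variance. -/
lemma sq_gaussMean_sub_le {ψ : ℝ → ℝ} (hm : Measurable ψ) {K : ℝ} (hK : 0 ≤ K)
    (h : ∀ t, |ψ t| ≤ K * (1 + t ^ 2)) {v w : ℝ} (hv : 1 ≤ v) (hw : 1 ≤ w) :
    (gaussMean ψ v - gaussMean ψ w) ^ 2 ≤ (8 * (K * stdMoment)) ^ 2 * (v - w) ^ 2 := by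
  rw [← mul_pow, sq_le_sq]
  have h0 : 0 ≤ 8 * (K * stdMoment) := by
    have := mul_nonneg hK stdMoment_nonneg
    linarith
  rw [abs_mul, abs_of_nonneg h0]
  rcases le_total w v with hwv | hvw
  · rw [abs_of_nonneg (sub_nonneg.2 hwv)]
    exact abs_gaussMean_sub_le hm hK h hw hwv
  · rw [abs_sub_comm, abs_sub_comm v, abs_of_nonneg (sub_nonneg.2 hvw)]
    exact abs_gaussMean_sub_le hm hK h hv hvw

lemma continuousOn_gaussMean {ψ : ℝ → ℝ} (hm : Measurable ψ) {K : ℝ} (hK : 0 ≤ K)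
    (h : ∀ t, |ψ t| ≤ K * (1 + t ^ 2)) : ContinuousOn (gaussMean ψ) (Set.Ici 1) := by
  have h0 : 0 ≤ 8 * (K * stdMoment) := by
    have := mul_nonneg hK stdMoment_nonneg
    linarith
  refine LipschitzOnWith.continuousOn (K := ⟨_, h0⟩)
    (LipschitzOnWith.of_dist_le_mul fun v hv w hw => ?_)
  have := sq_gaussMean_sub_le hm hK h hv hw
  rw [← mul_pow, sq_le_sq, abs_mul, abs_of_nonneg h0] at this
  rw [Real.dist_eq, Real.dist_eq]
  exact this

end GaussianMean

/-! ### Gaussian means determine the even part -/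

section GaussianMeanInjective

/-- The measure with density `f` with respect to the standard Gaussian measure. -/
noncomputable def gaussWith (f : ℝ → ℝ) : Measure ℝ :=
  (gaussianReal 0 1).withDensity fun t => ENNReal.ofReal (f t)

/-- Tilting the standard Gaussian by `exp (s * t ^ 2)` changes only its variance, up to
normalization. Gaussian means at varying variances thereby become values of one moment generating
function. -/
lemma exp_mul_gaussianPDFReal {s : ℝ} (hs : s < 1 / 2) (t : ℝ) :
    Real.exp (s * t ^ 2) * gaussianPDFReal 0 1 t
      = √(1 / (1 - 2 * s)) * gaussianPDFReal 0 (1 / (1 - 2 * s)).toNNReal t := by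
  have h1 : 0 < 1 - 2 * s := by linarith
  simp only [gaussianPDFReal, Real.coe_toNNReal _ (one_div_pos.2 h1).le, sub_zero]
  rw [Real.sqrt_mul (x := 2 * Real.pi) (y := 1 / (1 - 2 * s)) (by positivity)]
  have h2 : Real.exp (-t ^ 2 / (2 * (1 / (1 - 2 * s))))
      = Real.exp (s * t ^ 2) * Real.exp (-t ^ 2 / (2 * ((1 : ℝ≥0) : ℝ))) := by
    rw [← Real.exp_add]
    congr 1
    push_cast
    field_simp
    ring
  rw [h2]
  have h3 : 0 < √(1 / (1 - 2 * s)) := Real.sqrt_pos.2 (one_div_pos.2 h1)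
  have h4 : 0 < √(2 * Real.pi) := Real.sqrt_pos.2 (by positivity)
  generalize √(1 / (1 - 2 * s)) = q at h3 ⊢
  push_cast
  field_simp

variable {f : ℝ → ℝ} {K : ℝ}

lemma integrable_gaussianReal_iff_pdf {g : ℝ → ℝ} {v : ℝ≥0} (hv : v ≠ 0) :
    Integrable g (gaussianReal 0 v) ↔ Integrable (fun t => gaussianPDFReal 0 v t * g t) := by
  rw [gaussianReal_of_var_ne_zero _ hv,
    integrable_withDensity_iff_integrable_smul₀' (by fun_prop)
      (ae_of_all _ fun _ => gaussianPDF_lt_top)]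
  simp [toReal_gaussianPDF]

lemma integrable_gaussWith_iff (hf : Continuous f) (h0 : ∀ t, 0 ≤ f t) {g : ℝ → ℝ} :
    Integrable g (gaussWith f) ↔ Integrable (fun t => f t * g t) (gaussianReal 0 1) := by
  rw [gaussWith, integrable_withDensity_iff_integrable_smul₀'
    (hf.measurable.ennreal_ofReal.aemeasurable) (ae_of_all _ fun _ => ENNReal.ofReal_lt_top)]
  simp [h0]

lemma integral_gaussWith (hf : Continuous f) (h0 : ∀ t, 0 ≤ f t) (g : ℝ → ℝ) :
    ∫ t, g t ∂gaussWith f = ∫ t, f t * g t ∂gaussianReal 0 1 := by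
  rw [gaussWith, integral_withDensity_eq_integral_toReal_smul₀
    (hf.measurable.ennreal_ofReal.aemeasurable) (ae_of_all _ fun _ => ENNReal.ofReal_lt_top)]
  simp [h0]

lemma integrable_exp_sq_gaussWith (hf : Continuous f) (h0 : ∀ t, 0 ≤ f t)
    (h : ∀ t, |f t| ≤ K * (1 + t ^ 2)) {s : ℝ} (hs : s < 1 / 2) :
    Integrable (fun t => Real.exp (s * t ^ 2)) (gaussWith f) := by
  have hv : (1 / (1 - 2 * s)).toNNReal ≠ 0 := by
    have : 0 < 1 - 2 * s := by linarith
    rw [ne_eq, Real.toNNReal_eq_zero, not_le]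
    positivity
  rw [integrable_gaussWith_iff hf h0, integrable_gaussianReal_iff_pdf one_ne_zero]
  have := integrable_gaussianReal_of_growth (k := 1) hf.measurable (by simpa using h) 0
    (1 / (1 - 2 * s)).toNNReal
  rw [integrable_gaussianReal_iff_pdf hv] at this
  refine (this.const_mul √(1 / (1 - 2 * s))).congr (ae_of_all _ fun t => ?_)
  linear_combination f t * (-exp_mul_gaussianPDFReal hs t)

lemma mgf_sq_gaussWith (hf : Continuous f) (h0 : ∀ t, 0 ≤ f t) {s : ℝ} (hs : s < 1 / 2) :
    mgf (fun t => t ^ 2) (gaussWith f) s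
      = √(1 / (1 - 2 * s)) * gaussMean f (1 / (1 - 2 * s)) := by
  have : 0 < 1 - 2 * s := by linarith
  rw [mgf, integral_gaussWith hf h0, gaussMean_eq_integral_pdf hf.measurable (by positivity),
    integral_gaussianReal_eq_integral_smul one_ne_zero, ← integral_const_mul]
  refine integral_congr_ae (ae_of_all _ fun t => ?_)
  simp only [smul_eq_mul]
  linear_combination f t * (exp_mul_gaussianPDFReal hs t)

lemma isFiniteMeasure_gaussWith (hf : Continuous f) (h0 : ∀ t, 0 ≤ f t)
    (h : ∀ t, |f t| ≤ K * (1 + t ^ 2)) : IsFiniteMeasure (gaussWith f) := by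
  have := integrable_exp_sq_gaussWith hf h0 h (s := 0) (by norm_num)
  simp only [zero_mul, Real.exp_zero] at this
  exact (integrable_const_iff_isFiniteMeasure one_ne_zero).1 this

open Filter Topology in
/-- Densities with the same Gaussian means on an interval of variances induce the same law of the
square. -/
lemma map_sq_gaussWith_eq {f g : ℝ → ℝ} (hf : Continuous f) (hf0 : ∀ t, 0 ≤ f t)
    (hfK : ∀ t, |f t| ≤ K * (1 + t ^ 2)) (hg : Continuous g) (hg0 : ∀ t, 0 ≤ g t)
    (hgK : ∀ t, |g t| ≤ K * (1 + t ^ 2)) {α β : ℝ} (hα : 0 < α) (hαβ : α < β)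
    (h : ∀ v ∈ Set.Icc α β, gaussMean f v = gaussMean g v) :
    (gaussWith f).map (fun t => t ^ 2) = (gaussWith g).map (fun t => t ^ 2) := by
  have := isFiniteMeasure_gaussWith hf hf0 hfK
  have := isFiniteMeasure_gaussWith hg hg0 hgK
  set X : ℝ → ℝ := fun t => t ^ 2 with hX
  -- The complex moment generating function of the square is analytic on the half-plane `Re z < 1 /
  -- 2`, which contains the imaginary axis.
  have hsub : ∀ {f : ℝ → ℝ}, Continuous f → (∀ t, 0 ≤ f t) → (∀ t, |f t| ≤ K * (1 + t ^ 2)) →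
      AnalyticOnNhd ℂ (complexMGF X (gaussWith f)) {z | z.re < 1 / 2} := by
    intro f hf hf0 hfK
    refine analyticOnNhd_complexMGF.mono fun z hz => ?_
    refine mem_interior.2 ⟨Set.Iio (1 / 2), fun s hs => ?_, isOpen_Iio, hz⟩
    exact integrable_exp_sq_gaussWith hf hf0 hfK hs
  have hmgf : ∀ v ∈ Set.Icc α β, mgf X (gaussWith f) (1 / 2 - 1 / (2 * v))
      = mgf X (gaussWith g) (1 / 2 - 1 / (2 * v)) := by
    intro v hv
    have hv0 : 0 < v := hα.trans_le hv.1
    have h1 : 1 / 2 - 1 / (2 * v) < 1 / 2 := by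
      have : 0 < 1 / (2 * v) := by positivity
      linarith
    have h2 : 1 / (1 - 2 * (1 / 2 - 1 / (2 * v))) = v := by field_simp; ring
    rw [mgf_sq_gaussWith hf hf0 h1, mgf_sq_gaussWith hg hg0 h1, h2, h v hv]
  have hEq : Set.EqOn (complexMGF X (gaussWith f)) (complexMGF X (gaussWith g))
      {z | z.re < 1 / 2} := by
    -- The tilt `s₀` corresponds to the variance `(α + β) / 2`, interior to the interval, so the
    -- functions agree at real points accumulating at `s₀`.
    set s₀ : ℝ := 1 / 2 - 1 / (α + β) with hs₀
    have hβ : 0 < β := hα.trans hαβ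
    have hs₀2 : s₀ < 1 / 2 := by
      have : 0 < 1 / (α + β) := by positivity
      linarith
    refine AnalyticOnNhd.eqOn_of_preconnected_of_frequently_eq (hsub hf hf0 hfK) (hsub hg hg0 hgK)
      (convex_halfSpace_re_lt _).isPreconnected (z₀ := (s₀ : ℂ)) (by simpa using hs₀2) ?_
    have ht : Tendsto (fun s : ℝ => (s : ℂ)) (𝓝[≠] s₀) (𝓝[≠] (s₀ : ℂ)) := by
      rw [tendsto_nhdsWithin_iff]
      refine ⟨Complex.continuous_ofReal.continuousAt.tendsto.mono_left nhdsWithin_le_nhds, ?_⟩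
      filter_upwards [self_mem_nhdsWithin] with s hs
      simpa using hs
    refine ht.frequently (Eventually.frequently ?_)
    have hmem : Set.Ioo (1 / 2 - 1 / (2 * α)) (1 / 2 - 1 / (2 * β)) ∈ 𝓝 s₀ := by
      refine Ioo_mem_nhds ?_ ?_
      · have : 1 / (α + β) < 1 / (2 * α) := one_div_lt_one_div_of_lt (by positivity) (by linarith)
        linarith
      · have : 1 / (2 * β) < 1 / (α + β) := one_div_lt_one_div_of_lt (by positivity) (by linarith)
        linarith
    filter_upwards [nhdsWithin_le_nhds hmem] with s hs
    have h12 : 0 < 1 - 2 * s := by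
      have : 0 < 1 / (2 * β) := by positivity
      linarith [hs.2]
    have hs' : s = 1 / 2 - 1 / (2 * (1 / (1 - 2 * s))) := by field_simp; ring
    rw [complexMGF_ofReal, complexMGF_ofReal, hs', hmgf]
    have e1 : 1 - 2 * s < 1 / α := by
      have : 1 / (2 * α) = 1 / α / 2 := by field_simp
      linarith [hs.1]
    have e2 : 1 / β < 1 - 2 * s := by
      have : 1 / (2 * β) = 1 / β / 2 := by field_simp
      linarith [hs.2]
    constructor
    · rw [le_one_div hα h12]; exact e1.le
    · rw [one_div_le h12 hβ]; exact e2.le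
  refine Measure.ext_of_charFun (funext fun t => ?_)
  rw [← complexMGF_mul_I (by fun_prop), ← complexMGF_mul_I (by fun_prop)]
  exact hEq (by simp)

lemma gaussMean_add {f g : ℝ → ℝ} (hf : Measurable f) (hg : Measurable g)
    (hfK : ∀ t, |f t| ≤ K * (1 + t ^ 2)) (hgK : ∀ t, |g t| ≤ K * (1 + t ^ 2)) {v : ℝ}
    (hv : 0 ≤ v) : gaussMean (fun t => f t + g t) v = gaussMean f v + gaussMean g v := by
  rw [gaussMean_eq_integral (by fun_prop) hv, gaussMean_eq_integral hf hv,
    gaussMean_eq_integral hg hv]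
  exact integral_add (integrable_gaussianReal_of_growth (k := 1) hf (by simpa using hfK) _ _)
    (integrable_gaussianReal_of_growth (k := 1) hg (by simpa using hgK) _ _)

lemma gaussMean_const (c v : ℝ) : gaussMean (fun _ => c) v = c := by
  simp [gaussMean]

lemma gaussMean_comp_neg (f : ℝ → ℝ) (v : ℝ) :
    gaussMean (fun t => f (-t)) v = gaussMean f v := by
  have h : (gaussianReal 0 1).map (fun x => -x) = gaussianReal 0 1 := by
    rw [gaussianReal_map_neg]; simp
  unfold gaussMean
  conv_rhs => rw [← h]
  rw [MeasurableEmbedding.integral_map (f := fun x : ℝ => -x)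
    (MeasurableEquiv.neg ℝ).measurableEmbedding]
  simp

/-- An even continuous function whose Gaussian mean does not depend on the variance, for variances
in an interval, is constant. -/
lemma eq_of_even_of_gaussMean_eq {ψ : ℝ → ℝ} (hc : Continuous ψ)
    (h : ∀ t, |ψ t| ≤ K * (1 + t ^ 2)) (he : ∀ t, ψ (-t) = ψ t) {α β c : ℝ} (hα : 0 < α)
    (hαβ : α < β) (hG : ∀ v ∈ Set.Icc α β, gaussMean ψ v = c) (t : ℝ) : ψ t = c := by
  have hK : 0 ≤ K := by simpa using (abs_nonneg _).trans (h 0)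
  -- Adding `L`, which dominates both `|ψ|` and `|c|`, turns `ψ` and `c` into nonnegative densities
  -- without changing their difference.
  set L : ℝ → ℝ := fun t => (K + |c|) * (1 + t ^ 2) with hL
  have hψL : ∀ t, |ψ t| ≤ L t := fun t => (h t).trans (by
    simp only [hL]; gcongr; linarith [abs_nonneg c])
  have hcL : ∀ t, |c| ≤ L t := fun t => by
    simp only [hL]; nlinarith [abs_nonneg c, sq_nonneg t, mul_nonneg hK (sq_nonneg t),
      mul_nonneg (abs_nonneg c) (sq_nonneg t)]
  have hLabs : ∀ t, |L t| = L t := fun t => abs_of_nonneg ((abs_nonneg _).trans (hcL t))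
  have hLc : Continuous L := by fun_prop
  have hmap := map_sq_gaussWith_eq (K := 2 * (K + |c|)) (f := fun t => ψ t + L t)
    (g := fun t => c + L t) (by fun_prop) (fun t => by linarith [neg_abs_le (ψ t), hψL t])
    (fun t => (abs_add_le _ _).trans (by rw [hLabs]; linarith [hψL t])) (by fun_prop)
    (fun t => by linarith [neg_abs_le c, hcL t])
    (fun t => (abs_add_le _ _).trans (by rw [hLabs]; linarith [hcL t])) hα hαβ
    (fun v hv => by
      have hv0 : 0 ≤ v := hα.le.trans hv.1
      rw [gaussMean_add (K := K + |c|) hc.measurable hLc.measurable hψL (fun t => (hLabs t).le) hv0,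
        gaussMean_add (K := K + |c|) measurable_const hLc.measurable hcL (fun t => (hLabs t).le)
          hv0, hG v hv, gaussMean_const])
  have hroot : ∀ t, ψ (√(t ^ 2)) = ψ t := fun t => by
    rw [Real.sqrt_sq_eq_abs]
    rcases abs_choice t with h | h <;> rw [h]
    exact he t
  -- Since `ψ` is even, `(ψ t - c) / (1 + t ^ 2)` is a bounded function of `t ^ 2`. Testing the
  -- equality of laws against it gives `∫ (ψ - c) ^ 2 / (1 + t ^ 2) = 0`.
  set η : ℝ → ℝ := fun u => (ψ √u - c) / (1 + √u ^ 2) with hη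
  have hηc : Continuous η := by
    refine Continuous.div (by fun_prop) (by fun_prop) fun u => by positivity
  have hηt : ∀ t, η (t ^ 2) = (ψ t - c) / (1 + t ^ 2) := fun t => by
    simp only [hη, hroot, Real.sq_sqrt (sq_nonneg t)]
  have hint := congrArg (fun μ : Measure ℝ => ∫ u, η u ∂μ) hmap
  rw [integral_map (by fun_prop) hηc.aestronglyMeasurable,
    integral_map (by fun_prop) hηc.aestronglyMeasurable,
    integral_gaussWith (by fun_prop) (fun t => by linarith [neg_abs_le (ψ t), hψL t]),
    integral_gaussWith (by fun_prop) (fun t => by linarith [neg_abs_le c, hcL t])] at hint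
  have hηb : ∀ t, |η (t ^ 2)| ≤ K + |c| + (K + |c|) := fun t => by
    rw [hηt, abs_div, abs_of_pos (by positivity : (0 : ℝ) < 1 + t ^ 2), div_le_iff₀ (by positivity)]
    calc |ψ t - c| ≤ |ψ t| + |c| := abs_sub _ _
      _ ≤ L t + L t := add_le_add (hψL t) (hcL t)
      _ = _ := by simp only [hL]; ring
  have hii : ∀ {p : ℝ → ℝ}, Continuous p → (∀ t, |p t| ≤ L t) →
      Integrable (fun t => (p t + L t) * η (t ^ 2)) (gaussianReal 0 1) := by
    intro p hp hpL
    refine integrable_gaussianReal_of_growth (k := 1)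
      (K := 2 * (K + |c|) * (K + |c| + (K + |c|))) (by fun_prop) (fun t => ?_) _ _
    rw [abs_mul, pow_one]
    have h1 : |p t + L t| ≤ 2 * (K + |c|) * (1 + t ^ 2) :=
      (abs_add_le _ _).trans (by rw [hLabs]; linarith [hpL t])
    calc |p t + L t| * |η (t ^ 2)|
        ≤ (2 * (K + |c|) * (1 + t ^ 2)) * (K + |c| + (K + |c|)) := by
          gcongr
          exact hηb t
      _ = _ := by ring
  have hzero : ∫ t, (ψ t - c) ^ 2 / (1 + t ^ 2) ∂gaussianReal 0 1 = 0 := by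
    rw [← sub_eq_zero, ← integral_sub (hii hc hψL)
      (hii (p := fun _ => c) continuous_const hcL)] at hint
    refine Eq.trans ?_ hint
    refine integral_congr_ae (ae_of_all _ fun t => ?_)
    simp only [hηt]
    ring
  have hiz : Integrable (fun t => (ψ t - c) ^ 2 / (1 + t ^ 2)) (gaussianReal 0 1) := by
    refine ((hii hc hψL).sub (hii (p := fun _ => c) continuous_const hcL)).congr
      (ae_of_all _ fun t => ?_)
    simp only [Pi.sub_apply, hηt]
    ring
  rw [integral_eq_zero_iff_of_nonneg (fun t => by positivity) hiz] at hzero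
  -- Lebesgue measure is absolutely continuous with respect to the Gaussian, so the integrand
  -- vanishes Lebesgue-almost everywhere, and everywhere by continuity.
  have hvol := (gaussianReal_absolutelyContinuous' 0 one_ne_zero).ae_le hzero
  have hcont : Continuous (fun t => (ψ t - c) ^ 2 / (1 + t ^ 2)) :=
    Continuous.div (by fun_prop) (by fun_prop) fun t => by positivity
  have hall := (Continuous.ae_eq_iff_eq volume hcont continuous_zero).1 hvol
  have := congrFun hall t
  have hp : (1 + t ^ 2) ≠ 0 := by positivity
  simp only [Pi.zero_apply, div_eq_zero_iff, hp, or_false] at this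
  nlinarith [pow_eq_zero_iff (two_ne_zero) |>.1 this]

/-- If the Gaussian mean of a continuous function does not depend on the variance, for variances in
an interval, then the even part of the function is constant. -/
lemma evenPart_eq_of_gaussMean_eq {ψ : ℝ → ℝ} (hc : Continuous ψ)
    (h : ∀ t, |ψ t| ≤ K * (1 + t ^ 2)) {α β c : ℝ} (hα : 0 < α)
    (hαβ : α < β) (hG : ∀ v ∈ Set.Icc α β, gaussMean ψ v = c) (t : ℝ) : evenPart ψ t = c := by
  have hn : ∀ t, |ψ (-t)| ≤ K * (1 + t ^ 2) := fun t => by simpa using h (-t)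
  have hsum : ψ t + ψ (-t) = 2 * c := by
    refine eq_of_even_of_gaussMean_eq (ψ := fun t => ψ t + ψ (-t)) (K := 2 * K) (by fun_prop)
      (fun t => ?_) (fun t => ?_) hα hαβ (fun v hv => ?_) t
    · exact (abs_add_le _ _).trans (by linarith [h t, hn t])
    · rw [neg_neg, add_comm]
    · rw [gaussMean_add hc.measurable (by fun_prop) h hn (hα.le.trans hv.1),
        gaussMean_comp_neg, hG v hv]
      ring
  rw [evenPart, hsum]
  ring

end GaussianMeanInjective

/-! ### Limiting layer variances and their separation -/

section LayerVariance

variable {φ : ℝ → ℝ} {K : ℝ}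

/-- The limiting pre-activation variances of the layers of a wide network, for the variance `v` in
the first layer. -/
noncomputable def layerVar (φ : ℝ → ℝ) (v : ℝ) : ℕ → ℝ
  | 0 => v
  | l + 1 => 1 + gaussMean (fun t => φ t ^ 2) (layerVar φ v l)

lemma gaussMean_sq_nonneg (φ : ℝ → ℝ) (v : ℝ) : 0 ≤ gaussMean (fun t => φ t ^ 2) v :=
  integral_nonneg fun _ => sq_nonneg _

lemma one_le_layerVar (φ : ℝ → ℝ) {v : ℝ} (hv : 1 ≤ v) (l : ℕ) : 1 ≤ layerVar φ v l := by
  cases l with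
  | zero => exact hv
  | succ l => exact le_add_of_nonneg_right (gaussMean_sq_nonneg φ _)

lemma abs_sq_le_of_sq_le (h : ∀ t, φ t ^ 2 ≤ K * (1 + t ^ 2)) (t : ℝ) :
    |φ t ^ 2| ≤ K * (1 + t ^ 2) := by
  rw [abs_of_nonneg (sq_nonneg _)]; exact h t

lemma abs_le_of_sq_le (h : ∀ t, φ t ^ 2 ≤ K * (1 + t ^ 2)) (t : ℝ) :
    |φ t| ≤ (K + 1) * (1 + t ^ 2) := by
  nlinarith [h t, sq_abs (φ t), sq_nonneg (|φ t| - 1), sq_nonneg t]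

lemma nonneg_of_sq_le (h : ∀ t, φ t ^ 2 ≤ K * (1 + t ^ 2)) : 0 ≤ K := by
  simpa using (sq_nonneg _).trans (h 0)

/-- A continuous function on an interval that is not constant there has an image containing a
nondegenerate interval. -/
lemma exists_Icc_subset_image {q : ℝ → ℝ} {α β : ℝ} (hq : ContinuousOn q (Set.Icc α β))
    (hne : ∃ v ∈ Set.Icc α β, ∃ w ∈ Set.Icc α β, q v ≠ q w) :
    ∃ v ∈ Set.Icc α β, ∃ w ∈ Set.Icc α β, q v < q w ∧ Set.Icc (q v) (q w) ⊆ q '' Set.Icc α β := by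
  obtain ⟨v, hv, w, hw, hvw⟩ := hne
  rcases lt_or_gt_of_ne hvw with h | h
  · exact ⟨v, hv, w, hw, h, isPreconnected_Icc.intermediate_value hv hw hq⟩
  · exact ⟨w, hw, v, hv, h, isPreconnected_Icc.intermediate_value hw hv hq⟩

/-- A continuous function with nonconstant even part has nonconstant Gaussian means on every
interval of variances. -/
lemma exists_gaussMean_ne {ψ : ℝ → ℝ} (hc : Continuous ψ) (h : ∀ t, |ψ t| ≤ K * (1 + t ^ 2))
    {a a' : ℝ} (hne : evenPart ψ a ≠ evenPart ψ a') {α β : ℝ} (hα : 0 < α) (hαβ : α < β) :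
    ∃ v ∈ Set.Icc α β, ∃ w ∈ Set.Icc α β, gaussMean ψ v ≠ gaussMean ψ w := by
  by_contra! hcon
  have hmem : α ∈ Set.Icc α β := ⟨le_rfl, hαβ.le⟩
  have := evenPart_eq_of_gaussMean_eq hc h hα hαβ (fun v hv => hcon v hv α hmem)
  exact hne ((this a).trans (this a').symm)

/-- One layer acts on variances by a continuous map which, by (iv), is constant on no interval. It
therefore sends an interval onto a set containing another nondegenerate interval, and this passes
through any number of layers. -/
lemma exists_Icc_subset_image_layerVar (hc : Continuous φ)
    (h : ∀ t, φ t ^ 2 ≤ K * (1 + t ^ 2))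
    (hsq : ∃ a : ℝ, φ a ^ 2 + φ (-a) ^ 2 ≠ 2 * φ 0 ^ 2) (l : ℕ) :
    ∃ α β : ℝ, 1 ≤ α ∧ α < β ∧
      Set.Icc α β ⊆ (fun v => layerVar φ v l) '' Set.Icc 1 2 := by
  induction l with
  | zero => exact ⟨1, 2, le_rfl, by norm_num, by simp [layerVar]⟩
  | succ l ih =>
    obtain ⟨α, β, hα, hαβ, hsub⟩ := ih
    obtain ⟨a, ha⟩ := hsq
    have hK := nonneg_of_sq_le h
    have hcont : ContinuousOn (fun v => 1 + gaussMean (fun t => φ t ^ 2) v) (Set.Icc α β) :=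
      continuousOn_const.add ((continuousOn_gaussMean (by fun_prop) hK
        (abs_sq_le_of_sq_le h)).mono fun v hv => hα.trans hv.1)
    -- Condition (iv) says exactly that the even part of `φ ^ 2` takes different values at `a` and
    -- at `0`.
    obtain ⟨v, hv, w, hw, hvw⟩ := exists_gaussMean_ne (ψ := fun t => φ t ^ 2) (a := a) (a' := 0)
      (by fun_prop) (abs_sq_le_of_sq_le h) (by
        simp only [evenPart, neg_zero]
        intro h
        apply ha
        linarith) (by linarith : 0 < α) hαβ
    obtain ⟨v, hv, w, hw, hlt, hI⟩ := exists_Icc_subset_image hcont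
      ⟨v, hv, w, hw, by simpa using hvw⟩
    refine ⟨_, _, ?_, hlt, fun u hu => ?_⟩
    · linarith [gaussMean_sq_nonneg φ v]
    · obtain ⟨u', hu', rfl⟩ := hI hu
      obtain ⟨v', hv', rfl⟩ := hsub hu'
      exact ⟨v', hv', rfl⟩

/-- The two values found here become the first-layer variances of the two inputs of the dataset; any
number at least `1` is attained by some input. -/
lemma exists_gaussMean_layerVar_ne (hc : Continuous φ)
    (h : ∀ t, φ t ^ 2 ≤ K * (1 + t ^ 2))
    (heven : ∃ a a' : ℝ, evenPart φ a ≠ evenPart φ a')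
    (hsq : ∃ a : ℝ, φ a ^ 2 + φ (-a) ^ 2 ≠ 2 * φ 0 ^ 2) (l : ℕ) :
    ∃ v w : ℝ, 1 ≤ v ∧ 1 ≤ w ∧
      gaussMean φ (layerVar φ v l) ≠ gaussMean φ (layerVar φ w l) := by
  obtain ⟨α, β, hα, hαβ, hsub⟩ := exists_Icc_subset_image_layerVar hc h hsq l
  obtain ⟨a, a', ha⟩ := heven
  obtain ⟨v, hv, w, hw, hvw⟩ := exists_gaussMean_ne hc (abs_le_of_sq_le h) ha
    (by linarith : 0 < α) hαβ
  obtain ⟨v', hv', rfl⟩ := hsub hv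
  obtain ⟨w', hw', rfl⟩ := hsub hw
  exact ⟨v', w', hv'.1, hw'.1, hvw⟩

end LayerVariance

/-! ### Resampling, linear images and empirical means of product Gaussians -/

section ProductGaussian

variable {ι κ : Type*} [Fintype ι] [Fintype κ]

/-- Resampling the coordinates outside `S` preserves a product measure. -/
lemma measurePreserving_resample (μ : ι → Measure ℝ) [∀ i, IsProbabilityMeasure (μ i)]
    (S : ι → Prop) [DecidablePred S] :
    MeasurePreserving (fun q : (ι → ℝ) × (ι → ℝ) => fun p => if S p then q.1 p else q.2 p)
      ((Measure.pi μ).prod (Measure.pi μ)) (Measure.pi μ) := by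
  have hm : Measurable (fun q : (ι → ℝ) × (ι → ℝ) => fun p => if S p then q.1 p else q.2 p) := by
    refine measurable_pi_lambda _ fun p => ?_
    split_ifs <;> fun_prop
  refine ⟨hm, (Measure.pi_eq fun s hs => ?_).symm⟩
  rw [Measure.map_apply hm (MeasurableSet.univ_pi hs)]
  have : (fun q : (ι → ℝ) × (ι → ℝ) => fun p => if S p then q.1 p else q.2 p) ⁻¹' Set.univ.pi s
      = (Set.univ.pi fun p => if S p then s p else Set.univ) ×ˢ
        (Set.univ.pi fun p => if S p then Set.univ else s p) := by
    ext q
    simp only [Set.mem_preimage, Set.mem_pi, Set.mem_univ, true_imp_iff, Set.mem_prod]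
    rw [← forall_and]
    refine forall_congr' fun p => ?_
    split_ifs <;> simp
  rw [this, Measure.prod_prod, Measure.pi_pi, Measure.pi_pi, ← Finset.prod_mul_distrib]
  refine Finset.prod_congr rfl fun p _ => ?_
  split_ifs <;> simp

/-- Integrals over a product measure, computed by resampling the coordinates outside `S`. -/
lemma integral_eq_integral_resample (μ : ι → Measure ℝ) [∀ i, IsProbabilityMeasure (μ i)]
    (S : ι → Prop) [DecidablePred S] {F : (ι → ℝ) → ℝ} (hF : Integrable F (Measure.pi μ)) :
    ∫ θ, F θ ∂Measure.pi μ
      = ∫ θ, ∫ θ', F (fun p => if S p then θ p else θ' p) ∂Measure.pi μ ∂Measure.pi μ := by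
  have h := measurePreserving_resample μ S
  have hp := integral_prod _ (h.integrable_comp_of_integrable hF)
  rw [Function.comp_def] at hp
  rw [← hp]
  conv_lhs => rw [← h.map_eq]
  rw [integral_map h.aemeasurable (by rw [h.map_eq]; exact hF.aestronglyMeasurable)]

lemma hasLaw_eval_pi (p : ι) :
    HasLaw (fun θ : ι → ℝ => θ p) (gaussianReal 0 1)
      (Measure.pi fun _ : ι => gaussianReal 0 1) :=
  (measurePreserving_eval (fun _ : ι => gaussianReal 0 1) p).hasLaw

lemma hasGaussianLaw_pi :
    HasGaussianLaw (fun θ : ι → ℝ => (θ ·)) (Measure.pi fun _ : ι => gaussianReal 0 1) :=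
  iIndepFun.hasGaussianLaw (fun p => (hasLaw_eval_pi p).hasGaussianLaw)
    (iIndepFun_pi (X := fun _ => id) fun _ => aemeasurable_id)

/-- The image of a standard Gaussian vector under a linear map with orthogonal rows of norm `√V` is
a vector of independent centered Gaussian variables of variance `V`. -/
lemma map_linear_pi_gaussianReal [DecidableEq κ] (c : κ → ι → ℝ) {V : ℝ}
    (hc : ∀ i j, ∑ p, c i p * c j p = if i = j then V else 0) :
    (Measure.pi fun _ : ι => gaussianReal 0 1).map (fun θ i => ∑ p, c i p * θ p)
      = Measure.pi fun _ : κ => gaussianReal 0 V.toNNReal := by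
  classical
  set P := Measure.pi fun _ : ι => gaussianReal 0 1 with hP
  have hL : HasGaussianLaw (fun θ : ι → ℝ => fun i => ∑ p, c i p * θ p) P :=
    hasGaussianLaw_pi.map_fun
      (ContinuousLinearMap.pi fun i => ∑ p, c i p • ContinuousLinearMap.proj p) |>.congr
      (ae_of_all _ fun θ => by ext i; simp)
  have hmem : ∀ p : ι, MemLp (fun θ : ι → ℝ => θ p) 2 P := fun p =>
    (hasLaw_eval_pi p).hasGaussianLaw.memLp_two
  have hcov1 : ∀ p q : ι, cov[fun θ : ι → ℝ => θ p, fun θ => θ q; P] = if p = q then 1 else 0 := by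
    intro p q
    split_ifs with h
    · subst h
      rw [covariance_self (hmem p).aemeasurable, (hasLaw_eval_pi p).variance_eq]
      simp
    · exact ((iIndepFun_pi (X := fun _ => id) fun _ => aemeasurable_id).indepFun h
        ).covariance_eq_zero (hmem p) (hmem q)
  have hcov : ∀ i j, cov[fun θ : ι → ℝ => ∑ p, c i p * θ p, fun θ => ∑ p, c j p * θ p; P]
      = if i = j then V else 0 := by
    intro i j
    rw [covariance_fun_sum_fun_sum (fun p => (hmem p).const_mul _) (fun p => (hmem p).const_mul _),
      ← hc i j]
    refine Finset.sum_congr rfl fun p _ => ?_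
    simp [covariance_const_mul_left, covariance_const_mul_right, hcov1, mul_comm]
  have hind : iIndepFun (fun i (θ : ι → ℝ) => ∑ p, c i p * θ p) P :=
    hL.iIndepFun_of_covariance_eq_zero fun i j hij => by rw [hcov, if_neg hij]
  have hmeas : ∀ i, Measurable fun θ : ι → ℝ => ∑ p, c i p * θ p := fun i =>
    Finset.measurable_fun_sum _ fun p _ => (measurable_pi_apply p).const_mul _
  rw [hind.map_fun_eq_pi_map fun i => (hmeas i).aemeasurable]
  congr 1
  ext1 i
  have hi := hL.eval i
  rw [hi.map_eq_gaussianReal]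
  congr 1
  · rw [integral_finsetSum _ fun p _ => (hmem p).integrable (by norm_num) |>.const_mul _]
    refine Finset.sum_eq_zero fun p _ => ?_
    rw [integral_const_mul, (hasLaw_eval_pi p).integral_eq]
    simp
  · rw [← covariance_self (hmeas i).aemeasurable, hcov, if_pos rfl]

/-- The mean squared error of the empirical mean of `ψ` over independent Gaussian variables. -/
lemma integral_sq_average_sub {M : ℕ} (hM : 1 ≤ M) {ψ : ℝ → ℝ} (hm : Measurable ψ) {K : ℝ}
    (h : ∀ t, |ψ t| ≤ K * (1 + t ^ 2)) {v : ℝ} (hv : 0 ≤ v) (T : ℝ) :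
    ∫ z : Fin M → ℝ, (1 / (M : ℝ) * ∑ i, ψ (z i) - T) ^ 2
        ∂Measure.pi (fun _ : Fin M => gaussianReal 0 v.toNNReal)
      ≤ K ^ 2 * stdMoment * (1 + v) ^ 2 / M + (gaussMean ψ v - T) ^ 2 := by
  set γ := gaussianReal 0 v.toNNReal with hγ
  set μ := Measure.pi (fun _ : Fin M => γ) with hμ
  have hM0 : (0 : ℝ) < M := by exact_mod_cast hM
  have hψ2 : Integrable (fun t => ψ t ^ 2) γ := by
    refine integrable_gaussianReal_of_growth (by fun_prop) (K := K ^ 2) (k := 2) (fun t => ?_) _ _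
    rw [abs_pow, ← mul_pow]
    gcongr
    exact h t
  have hLp : MemLp ψ 2 γ := (memLp_two_iff_integrable_sq hm.aestronglyMeasurable).2 hψ2
  have hLpi : ∀ i : Fin M, MemLp (fun z : Fin M → ℝ => ψ (z i)) 2 μ := fun i =>
    hLp.comp_measurePreserving (measurePreserving_eval (fun _ : Fin M => γ) i)
  have hint : ∀ i : Fin M, ∫ z : Fin M → ℝ, ψ (z i) ∂μ = gaussMean ψ v := fun i => by
    rw [gaussMean_eq_integral hm hv, ← hγ, ← (measurePreserving_eval (fun _ : Fin M => γ) i).map_eq,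
      integral_map (measurable_pi_apply i).aemeasurable hm.aestronglyMeasurable]
  set A : (Fin M → ℝ) → ℝ := fun z => 1 / (M : ℝ) * ∑ i, ψ (z i) with hA
  have hALp : MemLp A 2 μ := (memLp_finsetSum _ fun i _ => hLpi i).const_mul _
  have hAm : ∫ z, A z ∂μ = gaussMean ψ v := by
    simp only [hA]
    rw [integral_const_mul, integral_finsetSum _ fun i _ => (hLpi i).integrable (by norm_num)]
    simp only [hint, Finset.sum_const, Finset.card_univ, Fintype.card_fin, nsmul_eq_mul]
    field_simp
  have hvar : Var[A; μ] ≤ K ^ 2 * stdMoment * (1 + v) ^ 2 / M := by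
    have h1 : Var[A; μ] = (1 / (M : ℝ)) ^ 2 * ∑ i : Fin M, Var[ψ; γ] := by
      rw [← variance_sum_pi (μ := fun _ : Fin M => γ) (X := fun _ => ψ) (fun _ => hLp),
        ← variance_const_mul]
      congr 1
      ext z
      simp [hA]
    have h2 : Var[ψ; γ] ≤ K ^ 2 * stdMoment * (1 + v) ^ 2 := by
      refine (variance_le_expectation_sq hm.aestronglyMeasurable).trans ?_
      refine le_trans (le_of_eq ?_) (gaussMean_sq_le h hv)
      rw [gaussMean_eq_integral (by fun_prop) hv]
      rfl
    rw [h1]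
    simp only [Finset.sum_const, Finset.card_univ, Fintype.card_fin, nsmul_eq_mul]
    calc (1 / (M : ℝ)) ^ 2 * (M * Var[ψ; γ]) = Var[ψ; γ] / M := by field_simp
      _ ≤ _ := by gcongr
  -- Bias-variance decomposition about the mean `gaussMean ψ v` of `A`.
  have hsplit : ∫ z, (A z - T) ^ 2 ∂μ = Var[A; μ] + (gaussMean ψ v - T) ^ 2 := by
    rw [variance_eq_integral hALp.aemeasurable, hAm]
    have hi1 : Integrable (fun z => (A z - gaussMean ψ v) ^ 2) μ :=
      (hALp.sub (memLp_const _)).integrable_sq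
    have hi2 : Integrable A μ := hALp.integrable (by norm_num)
    have : ∀ z, (A z - T) ^ 2 = (A z - gaussMean ψ v) ^ 2
        + (2 * (gaussMean ψ v - T) * (A z - gaussMean ψ v) + (gaussMean ψ v - T) ^ 2) := by
      intro z; ring
    simp only [this]
    have hi3 : Integrable (fun z => 2 * (gaussMean ψ v - T) * (A z - gaussMean ψ v)) μ :=
      (hi2.sub (integrable_const _)).const_mul _
    have hi4 : Integrable (fun z => 2 * (gaussMean ψ v - T) * (A z - gaussMean ψ v)
        + (gaussMean ψ v - T) ^ 2) μ := hi3.add (integrable_const _)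
    rw [integral_add hi1 hi4, integral_add hi3 (integrable_const _),
      integral_const_mul, integral_sub hi2 (integrable_const _), hAm]
    simp
  rw [hsplit]
  gcongr

end ProductGaussian

/-! ### Polynomial growth: integrability and continuity of Gaussian expectations -/

section PolynomialGrowth

variable {ι : Type*} [Fintype ι]

/-- Continuous real functions of at most polynomial growth on `ι → ℝ`. -/
structure PolyGrowth (F : (ι → ℝ) → ℝ) : Prop where
  continuous : Continuous F
  bound : ∃ C : ℝ, 0 ≤ C ∧ ∃ k : ℕ, ∀ θ, |F θ| ≤ C * (1 + ‖θ‖) ^ k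

namespace PolyGrowth

variable {F G : (ι → ℝ) → ℝ}

lemma const (c : ℝ) : PolyGrowth fun _ : ι → ℝ => c :=
  ⟨continuous_const, |c|, abs_nonneg c, 0, fun θ => by simp⟩

lemma eval (p : ι) : PolyGrowth fun θ : ι → ℝ => θ p :=
  ⟨continuous_apply p, 1, zero_le_one, 1, fun θ => by
    have := norm_le_pi_norm θ p
    rw [Real.norm_eq_abs] at this
    linarith⟩

lemma add (hF : PolyGrowth F) (hG : PolyGrowth G) : PolyGrowth fun θ => F θ + G θ := by
  obtain ⟨hFc, C, hC, k, hF⟩ := hF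
  obtain ⟨hGc, D, hD, m, hG⟩ := hG
  refine ⟨hFc.add hGc, C + D, add_nonneg hC hD, k + m, fun θ => (abs_add_le _ _).trans ?_⟩
  have h1 : 1 ≤ 1 + ‖θ‖ := by linarith [norm_nonneg θ]
  rw [add_mul]
  refine add_le_add ((hF θ).trans ?_) ((hG θ).trans ?_) <;> gcongr <;> first | exact h1 | omega

lemma mul (hF : PolyGrowth F) (hG : PolyGrowth G) : PolyGrowth fun θ => F θ * G θ := by
  obtain ⟨hFc, C, hC, k, hF⟩ := hF
  obtain ⟨hGc, D, hD, m, hG⟩ := hG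
  refine ⟨hFc.mul hGc, C * D, mul_nonneg hC hD, k + m, fun θ => ?_⟩
  rw [abs_mul, pow_add]
  calc |F θ| * |G θ| ≤ (C * (1 + ‖θ‖) ^ k) * (D * (1 + ‖θ‖) ^ m) := by
        gcongr
        · exact hF θ
        · exact hG θ
    _ = _ := by ring

lemma const_mul (hF : PolyGrowth F) (c : ℝ) : PolyGrowth fun θ => c * F θ := (const c).mul hF

lemma sub (hF : PolyGrowth F) (hG : PolyGrowth G) : PolyGrowth fun θ => F θ - G θ := by
  simpa [sub_eq_add_neg] using hF.add (hG.const_mul (-1))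

lemma pow (hF : PolyGrowth F) (n : ℕ) : PolyGrowth fun θ => F θ ^ n := by
  induction n with
  | zero => simpa using const 1
  | succ n ih => simpa [pow_succ] using ih.mul hF

lemma sum {κ : Type*} {s : Finset κ} {F : κ → (ι → ℝ) → ℝ} (hF : ∀ i, PolyGrowth (F i)) :
    PolyGrowth fun θ => ∑ i ∈ s, F i θ := by
  classical
  induction s using Finset.induction_on with
  | empty => simpa using const 0
  | insert a s ha ih => simpa [Finset.sum_insert ha] using (hF a).add ih

lemma comp_sq_le (hF : PolyGrowth F) {φ : ℝ → ℝ} (hφ : Continuous φ) {K : ℝ}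
    (h : ∀ t, |φ t| ≤ K * (1 + t ^ 2)) : PolyGrowth fun θ => φ (F θ) := by
  obtain ⟨-, C, hC, k, hb⟩ := ((const 1).add (hF.pow 2)).const_mul K
  exact ⟨hφ.comp hF.continuous, C, hC, k, fun θ =>
    ((h _).trans (le_abs_self _)).trans (hb θ)⟩

instance isGaussian_pi : IsGaussian (Measure.pi fun _ : ι => gaussianReal 0 1) := by
  have := (hasGaussianLaw_pi (ι := ι)).isGaussian_map
  simpa using this

/-- A Gaussian measure has finite moments of every order. -/
lemma integrable_one_add_norm_pow (k : ℕ) :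
    Integrable (fun θ : ι → ℝ => (1 + ‖θ‖) ^ k) (Measure.pi fun _ : ι => gaussianReal 0 1) := by
  have h1 : MemLp (fun θ : ι → ℝ => 1 + ‖θ‖) (k : ENNReal)
      (Measure.pi fun _ : ι => gaussianReal 0 1) :=
    (memLp_const (1 : ℝ)).add (IsGaussian.memLp_id _ _ (ENNReal.natCast_ne_top _)).norm
  refine h1.integrable_norm_pow'.congr (ae_of_all _ fun θ => ?_)
  have : 0 ≤ 1 + ‖θ‖ := by positivity
  simp only [Real.norm_of_nonneg this]

lemma integrable (hF : PolyGrowth F) :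
    Integrable F (Measure.pi fun _ : ι => gaussianReal 0 1) := by
  obtain ⟨hc, C, -, k, h⟩ := hF
  exact ((integrable_one_add_norm_pow k).const_mul C).mono' hc.aestronglyMeasurable
    (ae_of_all _ h)

lemma one_add_norm_affine_le {m s ξ : ι → ℝ} {R : ℝ} (hm : ‖m‖ ≤ R) (hs : ‖s‖ ≤ R) :
    1 + ‖fun p => m p + s p * ξ p‖ ≤ (1 + R) * (1 + ‖ξ‖) := by
  have hR : 0 ≤ R := (norm_nonneg m).trans hm
  have h1 : ‖fun p => m p + s p * ξ p‖ ≤ ‖m‖ + ‖s‖ * ‖ξ‖ :=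
    (norm_add_le m (s * ξ)).trans (add_le_add le_rfl (norm_mul_le s ξ))
  have h2 : ‖s‖ * ‖ξ‖ ≤ R * ‖ξ‖ := by gcongr
  nlinarith [norm_nonneg ξ]

lemma comp_affine (hF : PolyGrowth F) (m s : ι → ℝ) :
    PolyGrowth fun ξ => F fun p => m p + s p * ξ p := by
  obtain ⟨hc, C, hC, k, h⟩ := hF
  set R := max ‖m‖ ‖s‖
  have hR : 0 ≤ R := (norm_nonneg m).trans (le_max_left _ _)
  refine ⟨hc.comp (by fun_prop), C * (1 + R) ^ k, by positivity, k, fun ξ => (h _).trans ?_⟩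
  rw [mul_assoc, ← mul_pow]
  gcongr
  exact one_add_norm_affine_le (le_max_left _ _) (le_max_right _ _)

/-- Gaussian expectations depend continuously on the means and standard deviations. -/
lemma continuous_integral_affine (hF : PolyGrowth F) :
    Continuous fun q : (ι → ℝ) × (ι → ℝ) =>
      ∫ ξ, F (fun p => q.1 p + q.2 p * ξ p) ∂Measure.pi fun _ : ι => gaussianReal 0 1 := by
  obtain ⟨hc, C, hC, k, h⟩ := id hF
  refine continuous_iff_continuousAt.2 fun q₀ => ?_
  set R := ‖q₀‖ + 1
  refine continuousAt_of_dominated (bound := fun ξ => C * (1 + R) ^ k * (1 + ‖ξ‖) ^ k)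
    (Filter.Eventually.of_forall fun q =>
      (hF.comp_affine q.1 q.2).continuous.aestronglyMeasurable) ?_
    ((integrable_one_add_norm_pow k).const_mul _) (ae_of_all _ fun ξ => ?_)
  · filter_upwards [Metric.ball_mem_nhds q₀ one_pos] with q hq
    have hqR : ‖q‖ ≤ R := by
      have : ‖q - q₀‖ < 1 := by simpa [dist_eq_norm] using hq
      have h2 : ‖q‖ ≤ ‖q - q₀‖ + ‖q₀‖ := by simpa using norm_add_le (q - q₀) q₀
      simp only [R]; linarith
    refine ae_of_all _ fun ξ => (h _).trans ?_
    rw [mul_assoc, ← mul_pow]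
    gcongr
    exact one_add_norm_affine_le ((norm_fst_le q).trans hqR) ((norm_snd_le q).trans hqR)
  · exact (hc.comp (by fun_prop)).continuousAt

end PolyGrowth

end PolynomialGrowth

/-! ### The network as a linear function of the parameters of one layer -/

section NetworkStructure

variable {Din M H : ℕ}

/-- The parameters, grouped by kind. -/
def NNParam.equivSum : NNParam Din M H ≃
    (Fin M × Fin Din) ⊕ Fin M ⊕ (Fin H × Fin M × Fin M) ⊕ (Fin H × Fin M) ⊕ Fin M ⊕ Unit where
  toFun
    | .weightIn i j => .inl (i, j)
    | .biasIn i => .inr (.inl i)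
    | .weightHid l i j => .inr (.inr (.inl (l, i, j)))
    | .biasHid l i => .inr (.inr (.inr (.inl (l, i))))
    | .weightOut j => .inr (.inr (.inr (.inr (.inl j))))
    | .biasOut => .inr (.inr (.inr (.inr (.inr ()))))
  invFun
    | .inl (i, j) => .weightIn i j
    | .inr (.inl i) => .biasIn i
    | .inr (.inr (.inl (l, i, j))) => .weightHid l i j
    | .inr (.inr (.inr (.inl (l, i)))) => .biasHid l i
    | .inr (.inr (.inr (.inr (.inl j)))) => .weightOut j
    | .inr (.inr (.inr (.inr (.inr ())))) => .biasOut
  left_inv p := by cases p <;> rfl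
  right_inv := by rintro (_ | _ | _ | _ | _ | _) <;> rfl

lemma NNParam.sum_eq (f : NNParam Din M H → ℝ) :
    ∑ p, f p = ∑ i, ∑ j, f (.weightIn i j) + (∑ i, f (.biasIn i)
      + (∑ l, ∑ i, ∑ j, f (.weightHid l i j) + (∑ l, ∑ i, f (.biasHid l i)
      + (∑ j, f (.weightOut j) + f .biasOut)))) := by
  rw [← NNParam.equivSum.symm.sum_comp f]
  simp only [Fintype.sum_sum_type, Fintype.sum_prod_type, NNParam.equivSum, Equiv.coe_fn_symm_mk,
    Finset.univ_unique, Finset.sum_singleton]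

/-- The index of the layer that a parameter feeds into; the output is layer `H + 1`. -/
def NNParam.layer : NNParam Din M H → ℕ
  | .weightIn _ _ => 0
  | .biasIn _ => 0
  | .weightHid l _ _ => l + 1
  | .biasHid l _ => l + 1
  | .weightOut _ => H + 1
  | .biasOut => H + 1

variable {φ : ℝ → ℝ} {θ θ' : NNParam Din M H → ℝ} (x : EuclideanSpace ℝ (Fin Din))

lemma preact_congr {l : ℕ} (hl : l ≤ H) (h : ∀ p, NNParam.layer p ≤ l → θ p = θ' p) (i : Fin M) :
    preact φ θ x l hl i = preact φ θ' x l hl i := by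
  induction l generalizing i with
  | zero =>
    simp only [preact]
    rw [h (.biasIn i) le_rfl]
    simp only [fun j => h (.weightIn i j) le_rfl]
  | succ l ih =>
    simp only [preact]
    rw [h (.biasHid ⟨l, hl⟩ i) le_rfl]
    simp only [fun j => h (.weightHid ⟨l, hl⟩ i j) le_rfl,
      fun j => ih (Nat.le_of_succ_le hl) (fun p hp => h p (hp.trans (Nat.le_succ l))) j]

variable (φ θ)

/-- The conditional variance of the pre-activations of layer `l`, given the previous layers, for
standard Gaussian parameters; layer `H + 1` is the output. -/
noncomputable def preVar : (l : ℕ) → l ≤ H + 1 → ℝ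
  | 0, _ => 1 + (∑ j, x j ^ 2) / Din
  | l + 1, h => 1 + 1 / (M : ℝ) * ∑ j, φ (preact φ θ x l (Nat.le_of_succ_le_succ h) j) ^ 2

lemma one_le_preVar (l : ℕ) (hl : l ≤ H + 1) : 1 ≤ preVar φ θ x l hl := by
  cases l <;> simp only [preVar] <;> exact le_add_of_nonneg_right (by positivity)

/-- The coefficients of the pre-activations of layer `l` as linear functions of the parameters
feeding into that layer. -/
noncomputable def preCoef : (l : ℕ) → l ≤ H → Fin M → NNParam Din M H → ℝ
  | 0, _, i, .weightIn i' j => if i' = i then 1 / √(Din : ℝ) * x j else 0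
  | 0, _, i, .biasIn i' => if i' = i then 1 else 0
  | l + 1, h, i, .weightHid k i' j =>
      if k = ⟨l, h⟩ ∧ i' = i then 1 / √(M : ℝ) * φ (preact φ θ x l (Nat.le_of_succ_le h) j) else 0
  | l + 1, h, i, .biasHid k i' => if k = ⟨l, h⟩ ∧ i' = i then 1 else 0
  | _, _, _, _ => 0

/-- The coefficients of the output as a linear function of the parameters of the output layer. -/
noncomputable def outCoef : NNParam Din M H → ℝ
  | .weightOut j => 1 / √(M : ℝ) * φ (preact φ θ x H le_rfl j)
  | .biasOut => 1
  | _ => 0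

variable {θ}

/-- The coefficients are computed from `θ` and involve only earlier layers, where `θ'` agrees with
`θ`; the parameters of layer `l` itself enter linearly. This allows conditioning on the earlier
layers by freezing `θ`. -/
lemma preact_eq_sum_preCoef {l : ℕ} (hl : l ≤ H)
    (h : ∀ p, NNParam.layer p < l → θ p = θ' p) (i : Fin M) :
    preact φ θ' x l hl i = ∑ p, preCoef φ θ x l hl i p * θ' p := by
  rw [NNParam.sum_eq]
  cases l with
  | zero =>
    simp only [preact, preCoef, ite_mul, zero_mul, Finset.sum_const_zero, add_zero, one_mul,
      Finset.sum_ite_eq', Finset.mem_univ, if_true]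
    rw [Finset.sum_comm]
    simp [Finset.mul_sum, mul_comm, mul_left_comm]
  | succ l =>
    simp only [preact, preCoef, ite_mul, zero_mul, Finset.sum_const_zero, add_zero, one_mul,
      zero_add, ite_and]
    symm
    rw [Finset.sum_eq_single (⟨l, hl⟩ : Fin H) (by intro b _ hb; simp [hb]) (by simp),
      Finset.sum_eq_single i (by intro b _ hb; simp [hb]) (by simp), add_comm,
      Finset.sum_eq_single (⟨l, hl⟩ : Fin H) (by intro b _ hb; simp [hb]) (by simp),
      Finset.sum_eq_single i (by intro b _ hb; simp [hb]) (by simp)]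
    simp only [if_true, Finset.mul_sum]
    rw [add_comm]
    congr 1
    refine Finset.sum_congr rfl fun j _ => ?_
    rw [preact_congr x (Nat.le_of_succ_le hl) (fun p hp => (h p (Nat.lt_succ_of_le hp)).symm) j]
    ring

/-- Distinct neurons use disjoint sets of weights, hence orthogonal rows; all neurons see the same
activations, hence rows of equal norm. -/
lemma sum_preCoef_mul (hDin : 1 ≤ Din) (hM : 1 ≤ M) {l : ℕ} (hl : l ≤ H) (i j : Fin M) :
    ∑ p, preCoef φ θ x l hl i p * preCoef φ θ x l hl j p
      = if i = j then preVar φ θ x l (hl.trans (Nat.le_succ H)) else 0 := by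
  have hM0 : (0 : ℝ) < M := by exact_mod_cast hM
  have hD0 : (0 : ℝ) < Din := by exact_mod_cast hDin
  rw [NNParam.sum_eq]
  cases l with
  | zero =>
    simp only [preCoef, mul_zero, Finset.sum_const_zero, add_zero, ite_mul, zero_mul]
    rw [Finset.sum_eq_single i (by intro b _ hb; simp [hb]) (by simp),
      Finset.sum_eq_single i (by intro b _ hb; simp [hb]) (by simp)]
    by_cases hij : i = j
    · subst hij
      simp only [if_true, preVar, one_mul, add_comm, Finset.sum_div]
      congr 1
      refine Finset.sum_congr rfl fun j _ => ?_
      rw [mul_mul_mul_comm, div_mul_div_comm, Real.mul_self_sqrt hD0.le]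
      ring
    · simp [hij]
  | succ l =>
    simp only [preCoef, mul_zero, Finset.sum_const_zero, add_zero, zero_add, ite_mul, zero_mul,
      ite_and]
    rw [Finset.sum_eq_single (⟨l, hl⟩ : Fin H) (by intro b _ hb; simp [hb]) (by simp),
      Finset.sum_eq_single i (by intro b _ hb; simp [hb]) (by simp), add_comm,
      Finset.sum_eq_single (⟨l, hl⟩ : Fin H) (by intro b _ hb; simp [hb]) (by simp),
      Finset.sum_eq_single i (by intro b _ hb; simp [hb]) (by simp)]
    by_cases hij : i = j
    · subst hij
      simp only [if_true, preVar, one_mul, Finset.mul_sum]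
      congr 1
      refine Finset.sum_congr rfl fun j _ => ?_
      rw [mul_mul_mul_comm, div_mul_div_comm, Real.mul_self_sqrt hM0.le]
      ring
    · simp [hij]

lemma network_eq_sum_outCoef (h : ∀ p, NNParam.layer p < H + 1 → θ p = θ' p) :
    network φ θ' x = ∑ p, outCoef φ θ x p * θ' p := by
  rw [NNParam.sum_eq]
  simp only [network, outCoef, zero_mul, Finset.sum_const_zero, zero_add, one_mul, Finset.mul_sum]
  congr 1
  refine Finset.sum_congr rfl fun j _ => ?_
  rw [preact_congr x le_rfl (fun p hp => (h p (Nat.lt_succ_of_le hp)).symm) j]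
  ring

lemma sum_outCoef_mul_self (hM : 1 ≤ M) :
    ∑ p, outCoef φ θ x p * outCoef φ θ x p = preVar φ θ x (H + 1) le_rfl := by
  have hM0 : (0 : ℝ) < M := by exact_mod_cast hM
  rw [NNParam.sum_eq]
  simp only [preVar, outCoef, zero_mul, Finset.sum_const_zero, zero_add, one_mul, Finset.mul_sum]
  rw [add_comm]
  congr 1
  refine Finset.sum_congr rfl fun j _ => ?_
  rw [mul_mul_mul_comm, div_mul_div_comm, Real.mul_self_sqrt hM0.le]
  ring

variable {φ} {K : ℝ}

lemma polyGrowth_preact (hφ : Continuous φ) (h : ∀ t, |φ t| ≤ K * (1 + t ^ 2)) {l : ℕ}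
    (hl : l ≤ H) (i : Fin M) :
    PolyGrowth fun θ : NNParam Din M H → ℝ => preact φ θ x l hl i := by
  induction l generalizing i with
  | zero =>
    exact ((PolyGrowth.sum fun j => (PolyGrowth.eval _).mul (.const _)).const_mul _).add (.eval _)
  | succ l ih =>
    exact ((PolyGrowth.sum fun j => (PolyGrowth.eval _).mul
      ((ih (Nat.le_of_succ_le hl) j).comp_sq_le hφ h)).const_mul _).add (.eval _)

lemma polyGrowth_network (hφ : Continuous φ) (h : ∀ t, |φ t| ≤ K * (1 + t ^ 2)) :
    PolyGrowth fun θ : NNParam Din M H → ℝ => network φ θ x :=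
  ((PolyGrowth.sum fun j => (PolyGrowth.eval _).mul
    ((polyGrowth_preact x hφ h le_rfl j).comp_sq_le hφ h)).const_mul _).add (.eval _)

lemma polyGrowth_preVar (hφ : Continuous φ) (h : ∀ t, |φ t| ≤ K * (1 + t ^ 2)) {l : ℕ}
    (hl : l ≤ H + 1) : PolyGrowth fun θ : NNParam Din M H → ℝ => preVar φ θ x l hl := by
  cases l with
  | zero => exact .const _
  | succ l =>
    exact (PolyGrowth.const 1).add ((PolyGrowth.sum fun j =>
      ((polyGrowth_preact x hφ h _ j).comp_sq_le hφ h).pow 2).const_mul _)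

end NetworkStructure

/-! ### Concentration of the prior network, layer by layer -/

section Propagation

variable {Din M H : ℕ} {φ : ℝ → ℝ} (x : EuclideanSpace ℝ (Fin Din))

lemma preCoef_eq_zero (θ : NNParam Din M H → ℝ) {l : ℕ} (hl : l ≤ H) (i : Fin M)
    {p : NNParam Din M H} (hp : NNParam.layer p < l) : preCoef φ θ x l hl i p = 0 := by
  cases l with
  | zero => omega
  | succ l =>
    cases p <;> simp only [preCoef] <;> rw [if_neg] <;> rintro ⟨rfl, -⟩ <;>
      simp [NNParam.layer] at hp

lemma outCoef_eq_zero (θ : NNParam Din M H → ℝ) {p : NNParam Din M H}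
    (hp : NNParam.layer p < H + 1) : outCoef φ θ x p = 0 := by
  cases p <;> simp [outCoef, NNParam.layer] at hp ⊢

lemma sum_mul_resample {ι : Type*} [Fintype ι] {S : ι → Prop} [DecidablePred S] {c : ι → ℝ}
    (hc : ∀ p, S p → c p = 0) (θ θ' : ι → ℝ) :
    ∑ p, c p * (if S p then θ p else θ' p) = ∑ p, c p * θ' p := by
  refine Finset.sum_congr rfl fun p _ => ?_
  split_ifs with h
  · simp [hc p h]
  · rfl

/-- Given the previous layers, the pre-activations of a layer of the prior network are independent
centered Gaussian variables. -/
lemma integral_comp_preact (hDin : 1 ≤ Din) (hM : 1 ≤ M) {l : ℕ} (hl : l ≤ H)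
    {h : (Fin M → ℝ) → ℝ} (hh : Measurable h)
    (hint : Integrable (fun θ => h (preact φ θ x l hl)) (nnPrior Din M H)) :
    ∫ θ, h (preact φ θ x l hl) ∂nnPrior Din M H
      = ∫ θ, ∫ z, h z ∂Measure.pi (fun _ : Fin M => gaussianReal 0
          (preVar φ θ x l (hl.trans (Nat.le_succ H))).toNNReal) ∂nnPrior Din M H := by
  unfold nnPrior factorizedGaussian at hint ⊢
  rw [integral_eq_integral_resample _ (fun p => NNParam.layer p < l) hint]
  refine integral_congr_ae (ae_of_all _ fun θ => ?_)
  simp only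
  have hpre : ∀ θ' : NNParam Din M H → ℝ,
      preact φ (fun p => if NNParam.layer p < l then θ p else θ' p) x l hl
        = fun i => ∑ p, preCoef φ θ x l hl i p * θ' p := by
    intro θ'
    ext i
    -- The coefficients vanish on the frozen parameters, so only resampled ones remain in the sum.
    rw [preact_eq_sum_preCoef (θ := θ) φ x hl (fun p hp => by simp [hp]) i,
      sum_mul_resample fun p hp => preCoef_eq_zero x θ hl i hp]
  simp only [hpre]
  rw [← map_linear_pi_gaussianReal _ (sum_preCoef_mul φ x hDin hM hl), integral_map _
    hh.aestronglyMeasurable]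
  exact (measurable_pi_lambda _ fun i => Finset.measurable_fun_sum _ fun p _ =>
    (measurable_pi_apply p).const_mul _).aemeasurable

/-- Given the hidden layers, the output of the prior network is a centered Gaussian variable. -/
lemma integral_comp_network (hM : 1 ≤ M) {h : ℝ → ℝ} (hh : Measurable h)
    (hint : Integrable (fun θ => h (network φ θ x)) (nnPrior Din M H)) :
    ∫ θ, h (network φ θ x) ∂nnPrior Din M H
      = ∫ θ, ∫ t, h t ∂gaussianReal 0 (preVar φ θ x (H + 1) le_rfl).toNNReal
          ∂nnPrior Din M H := by
  unfold nnPrior factorizedGaussian at hint ⊢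
  rw [integral_eq_integral_resample _ (fun p => NNParam.layer p < H + 1) hint]
  refine integral_congr_ae (ae_of_all _ fun θ => ?_)
  simp only
  have hnet : ∀ θ' : NNParam Din M H → ℝ,
      network φ (fun p => if NNParam.layer p < H + 1 then θ p else θ' p) x
        = ∑ p, outCoef φ θ x p * θ' p := by
    intro θ'
    rw [network_eq_sum_outCoef (θ := θ) φ x (fun p hp => by simp [hp]),
      sum_mul_resample fun p hp => outCoef_eq_zero x θ hp]
  simp only [hnet]
  -- The output is the case of a single row, indexed by `Unit`.
  have hmap := map_linear_pi_gaussianReal (κ := Unit) (fun _ => outCoef φ θ x)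
    (V := preVar φ θ x (H + 1) le_rfl) (fun i j => by simp [sum_outCoef_mul_self φ x hM])
  have hlin : Measurable fun θ' : NNParam Din M H → ℝ => ∑ p, outCoef φ θ x p * θ' p :=
    Finset.measurable_fun_sum _ fun p _ => (measurable_pi_apply p).const_mul _
  rw [← (measurePreserving_eval (fun _ : Unit => gaussianReal 0
    (preVar φ θ x (H + 1) le_rfl).toNNReal) ()).map_eq, ← hmap,
    Measure.map_map (measurable_pi_apply _) (measurable_pi_lambda _ fun _ => hlin),
    integral_map _ hh.aestronglyMeasurable]
  · rfl
  · exact hlin.aemeasurable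

variable {K : ℝ}

/-- The mean squared deviation of the empirical mean of `ψ` over a layer of the prior network,
in terms of the deviation of the empirical variance of that layer. -/
lemma integral_sq_average_preact_sub_le (hDin : 1 ≤ Din) (hM : 1 ≤ M) (hφ : Continuous φ)
    {K' : ℝ} (hφK : ∀ t, |φ t| ≤ K' * (1 + t ^ 2)) {ψ : ℝ → ℝ} (hψ : Continuous ψ)
    (hψK : ∀ t, |ψ t| ≤ K * (1 + t ^ 2)) {l : ℕ} (hl : l ≤ H) {w C : ℝ} (hw : 1 ≤ w)
    (hC : ∫ θ, (preVar φ θ x l (hl.trans (Nat.le_succ H)) - w) ^ 2 ∂nnPrior Din M H ≤ C / M) :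
    ∫ θ, (1 / (M : ℝ) * ∑ i, ψ (preact φ θ x l hl i) - gaussMean ψ w) ^ 2 ∂nnPrior Din M H
      ≤ (2 * K ^ 2 * stdMoment * ((1 + w) ^ 2 + C) + (8 * (K * stdMoment)) ^ 2 * C) / M := by
  have hM1 : (1 : ℝ) ≤ M := by exact_mod_cast hM
  have hM0 : (0 : ℝ) < M := by linarith
  have hK : 0 ≤ K := by simpa using (abs_nonneg _).trans (hψK 0)
  have hS := stdMoment_nonneg
  set P := nnPrior Din M H with hP
  set V : (NNParam Din M H → ℝ) → ℝ := fun θ => preVar φ θ x l (hl.trans (Nat.le_succ H)) with hV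
  have hV1 : ∀ θ, 1 ≤ V θ := fun θ => one_le_preVar φ θ x l _
  have hVg : PolyGrowth V := polyGrowth_preVar x hφ hφK _
  have hgrow : PolyGrowth fun θ : NNParam Din M H → ℝ =>
      (1 / (M : ℝ) * ∑ i, ψ (preact φ θ x l hl i) - gaussMean ψ w) ^ 2 :=
    (((PolyGrowth.sum fun i => (polyGrowth_preact x hφ hφK hl i).comp_sq_le hψ hψK).const_mul
      _).sub (.const _)).pow 2
  rw [integral_comp_preact (h := fun z => (1 / (M : ℝ) * ∑ i, ψ (z i) - gaussMean ψ w) ^ 2) x hDin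
    hM hl (by fun_prop) hgrow.integrable]
  have hdev : Integrable (fun θ => (V θ - w) ^ 2) P := ((hVg.sub (.const w)).pow 2).integrable
  calc _ ≤ ∫ θ, (2 * K ^ 2 * stdMoment / M * ((1 + w) ^ 2 + (V θ - w) ^ 2)
        + (8 * (K * stdMoment)) ^ 2 * (V θ - w) ^ 2) ∂P := by
        refine integral_mono_of_nonneg (ae_of_all _ fun θ => integral_nonneg fun z => sq_nonneg _)
          ?_ (ae_of_all _ fun θ => ?_)
        · have : IsProbabilityMeasure P := by
            rw [hP]; unfold nnPrior factorizedGaussian; infer_instance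
          exact ((((integrable_const _).add hdev).const_mul _).add (hdev.const_mul _))
        · have hθ := hV1 θ
          -- The conditional variance is of order `(1 + V θ) ^ 2 / M`; the conditional squared bias
          -- is controlled by `(V θ - w) ^ 2`, as both variances are at least `1`.
          refine (integral_sq_average_sub hM hψ.measurable hψK (by linarith) _).trans ?_
          refine add_le_add ?_ (sq_gaussMean_sub_le hψ.measurable hK hψK hθ hw)
          rw [div_mul_eq_mul_div]
          refine div_le_div_of_nonneg_right ?_ hM0.le
          have : (1 + V θ) ^ 2 ≤ 2 * ((1 + w) ^ 2 + (V θ - w) ^ 2) := by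
            nlinarith [sq_nonneg ((1 + w) - (V θ - w))]
          have h0 : 0 ≤ K ^ 2 * stdMoment := by positivity
          calc K ^ 2 * stdMoment * (1 + V θ) ^ 2
              ≤ K ^ 2 * stdMoment * (2 * ((1 + w) ^ 2 + (V θ - w) ^ 2)) := by gcongr
            _ = _ := by ring
    _ = 2 * K ^ 2 * stdMoment / M * ((1 + w) ^ 2 + ∫ θ, (V θ - w) ^ 2 ∂P)
        + (8 * (K * stdMoment)) ^ 2 * ∫ θ, (V θ - w) ^ 2 ∂P := by
        have : IsProbabilityMeasure P := by
          rw [hP]; unfold nnPrior factorizedGaussian; infer_instance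
        have hi : Integrable (fun θ => (1 + w) ^ 2 + (V θ - w) ^ 2) P :=
          (integrable_const _).add hdev
        rw [integral_add (hi.const_mul _) (hdev.const_mul _), integral_const_mul,
          integral_const_mul, integral_add (integrable_const _) hdev]
        simp
    _ ≤ 2 * K ^ 2 * stdMoment / M * ((1 + w) ^ 2 + C) + (8 * (K * stdMoment)) ^ 2 * (C / M) := by
        have hC0 : 0 ≤ C := by
          have := (integral_nonneg fun θ => sq_nonneg (V θ - w)).trans hC
          rcases le_or_gt 0 C with h | h
          · exact h
          · exact absurd this (not_le.2 (div_neg_of_neg_of_pos h hM0))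
        have hCM : C / M ≤ C := div_le_self hC0 hM1
        gcongr
        exact hC.trans hCM
    _ = _ := by ring

/-- The first-layer pre-activation variance at the input `x`. -/
noncomputable def inputVar (x : EuclideanSpace ℝ (Fin Din)) : ℝ := 1 + (∑ j, x j ^ 2) / Din

lemma one_le_inputVar : 1 ≤ inputVar x := le_add_of_nonneg_right (by positivity)

/-- The empirical variances of the layers of the prior network concentrate as the width grows. -/
lemma exists_integral_sq_preVar_sub_le (hDin : 1 ≤ Din) (hφ : Continuous φ)
    (h : ∀ t, φ t ^ 2 ≤ K * (1 + t ^ 2)) (H l : ℕ) (hl : l ≤ H + 1) :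
    ∃ C : ℝ, ∀ M : ℕ, 1 ≤ M →
      ∫ θ, (preVar φ θ x l hl - layerVar φ (inputVar x) l) ^ 2 ∂nnPrior Din M H ≤ C / M := by
  induction l with
  -- The first-layer variance is deterministic.
  | zero => exact ⟨0, fun M _ => by simp [preVar, layerVar, inputVar]⟩
  | succ l ih =>
    obtain ⟨C, hC⟩ := ih (Nat.le_of_succ_le hl)
    -- The bias variance `1` cancels, leaving the deviation of the empirical mean of `φ ^ 2`; the
    -- resulting constant involves no `M`.
    refine ⟨_, fun M hM => le_trans (le_of_eq ?_) (integral_sq_average_preact_sub_le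
      (ψ := fun t => φ t ^ 2) x hDin hM hφ (abs_le_of_sq_le h) (by fun_prop)
      (abs_sq_le_of_sq_le h) (Nat.le_of_succ_le_succ hl)
      (one_le_layerVar φ (one_le_inputVar x) l) (hC M hM))⟩
    refine integral_congr_ae (ae_of_all _ fun θ => ?_)
    simp only [preVar, layerVar]
    ring

/-- The empirical mean activation of the last hidden layer of the prior network concentrates as the
width grows. -/
lemma exists_integral_sq_average_sub_le (hDin : 1 ≤ Din) (hφ : Continuous φ)
    (h : ∀ t, φ t ^ 2 ≤ K * (1 + t ^ 2)) (H : ℕ) :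
    ∃ C : ℝ, ∀ M : ℕ, 1 ≤ M →
      ∫ θ, (1 / (M : ℝ) * ∑ i, φ (preact φ θ x H le_rfl i)
        - gaussMean φ (layerVar φ (inputVar x) H)) ^ 2 ∂nnPrior Din M H ≤ C / M := by
  obtain ⟨C, hC⟩ := exists_integral_sq_preVar_sub_le x hDin hφ h H H (Nat.le_succ H)
  exact ⟨_, fun M hM => integral_sq_average_preact_sub_le x hDin hM hφ (abs_le_of_sq_le h) hφ
    (abs_le_of_sq_le h) le_rfl (one_le_layerVar φ (one_le_inputVar x) H) (hC M hM)⟩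

/-- The second moment of the output of the prior network is bounded in the width. -/
lemma exists_integral_sq_network_le (hDin : 1 ≤ Din) (hφ : Continuous φ)
    (h : ∀ t, φ t ^ 2 ≤ K * (1 + t ^ 2)) (H : ℕ) :
    ∃ C : ℝ, ∀ M : ℕ, 1 ≤ M → ∫ θ, network φ θ x ^ 2 ∂nnPrior Din M H ≤ C := by
  obtain ⟨C, hC⟩ := exists_integral_sq_preVar_sub_le x hDin hφ h H (H + 1) le_rfl
  set w := layerVar φ (inputVar x) (H + 1)
  refine ⟨w + 1 + |C|, fun M hM => ?_⟩
  have hM1 : (1 : ℝ) ≤ M := by exact_mod_cast hM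
  have : IsProbabilityMeasure (nnPrior Din M H) := by
    unfold nnPrior factorizedGaussian; infer_instance
  rw [integral_comp_network (h := fun t => t ^ 2) x hM (by fun_prop)
    ((polyGrowth_network x hφ (abs_le_of_sq_le h)).pow 2).integrable]
  have hVg := polyGrowth_preVar (M := M) x hφ (abs_le_of_sq_le h) (le_refl (H + 1))
  have hdev : Integrable (fun θ => (preVar φ θ x (H + 1) le_rfl - w) ^ 2) (nnPrior Din M H) :=
    ((hVg.sub (.const w)).pow 2).integrable
  have hsec : ∀ v : ℝ≥0, ∫ t, t ^ 2 ∂gaussianReal 0 v = v := fun v => by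
    have := variance_fun_id_gaussianReal (μ := 0) (v := v)
    rw [variance_eq_integral (by fun_prop)] at this
    simpa using this
  simp only [hsec]
  -- This uses `V ≤ w + 1 + (V - w) ^ 2`, where `V` is the conditional variance of the output.
  calc _ ≤ ∫ θ, ((w + 1) + (preVar φ θ x (H + 1) le_rfl - w) ^ 2) ∂nnPrior Din M H := by
        refine integral_mono_of_nonneg (ae_of_all _ fun θ => NNReal.coe_nonneg _)
          ((integrable_const _).add hdev) (ae_of_all _ fun θ => ?_)
        have h1 := one_le_preVar φ θ x (H + 1) le_rfl
        simp only [Real.coe_toNNReal _ (zero_le_one.trans h1)]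
        nlinarith [sq_nonneg (preVar φ θ x (H + 1) le_rfl - w - 1)]
    _ = w + 1 + ∫ θ, (preVar φ θ x (H + 1) le_rfl - w) ^ 2 ∂nnPrior Din M H := by
        rw [integral_add (integrable_const _) hdev]
        simp
    _ ≤ w + 1 + |C| := by
        gcongr
        refine (hC M hM).trans ((div_le_div_of_nonneg_right (le_abs_self C) (by linarith)).trans ?_)
        exact div_le_self (abs_nonneg C) hM1

/-- The prior predictive mean vanishes. -/
lemma predictiveMean_nnPrior (hM : 1 ≤ M) (hφ : Continuous φ)
    (h : ∀ t, φ t ^ 2 ≤ K * (1 + t ^ 2)) : predictiveMean φ (nnPrior Din M H) x = 0 := by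
  rw [predictiveMean, integral_comp_network (h := fun t => t) x hM (by fun_prop)
    (polyGrowth_network x hφ (abs_le_of_sq_le h)).integrable]
  simp

end Propagation

/-! ### Kullback-Leibler divergence of factorized Gaussians -/

section KullbackLeibler

open InformationTheory

variable {ι : Type*} [Fintype ι]

/-- On a box, the density times the indicator is a product of functions of single coordinates, which
are independent, so its integral factorizes. -/
lemma pi_withDensity {X : ι → Type*} [∀ i, MeasurableSpace (X i)] (μ : ∀ i, Measure (X i))
    [∀ i, IsProbabilityMeasure (μ i)] {f : ∀ i, X i → ENNReal} (hf : ∀ i, Measurable (f i))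
    [∀ i, SigmaFinite ((μ i).withDensity (f i))] :
    Measure.pi (fun i => (μ i).withDensity (f i))
      = (Measure.pi μ).withDensity fun x => ∏ i, f i (x i) := by
  refine Measure.pi_eq fun s hs => ?_
  have hind : iIndepFun (fun i (x : ∀ i, X i) => (s i).indicator (f i) (x i)) (Measure.pi μ) :=
    iIndepFun_pi fun i => ((hf i).indicator (hs i)).aemeasurable
  rw [withDensity_apply _ (MeasurableSet.univ_pi hs),
    ← lintegral_indicator (MeasurableSet.univ_pi hs)]
  have h1 : ∀ x : ∀ i, X i, (Set.univ.pi s).indicator (fun x => ∏ i, f i (x i)) x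
      = ∏ i, (s i).indicator (f i) (x i) := by
    intro x
    by_cases hx : x ∈ Set.univ.pi s
    · rw [Set.indicator_of_mem hx]
      exact Finset.prod_congr rfl fun i _ => (Set.indicator_of_mem (hx i trivial) _).symm
    · rw [Set.indicator_of_notMem hx]
      simp only [Set.mem_pi, Set.mem_univ, true_imp_iff, not_forall] at hx
      obtain ⟨i, hi⟩ := hx
      exact (Finset.prod_eq_zero (Finset.mem_univ i) (Set.indicator_of_notMem hi _)).symm
  simp only [h1]
  rw [lintegral_prod_eq_prod_lintegral_of_indepFun Finset.univ _ hind
    fun i => ((hf i).indicator (hs i)).comp (measurable_pi_apply i)]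
  refine Finset.prod_congr rfl fun i _ => ?_
  rw [withDensity_apply _ (hs i), ← lintegral_indicator (hs i),
    ← (measurePreserving_eval μ i).map_eq, lintegral_map ((hf i).indicator (hs i))
      (measurable_pi_apply i)]

/-- The logarithm of the density of a Gaussian with respect to the standard Gaussian. -/
noncomputable def logRatio (m : ℝ) (v : ℝ≥0) (t : ℝ) : ℝ :=
  -(Real.log v / 2) - (t - m) ^ 2 / (2 * v) + t ^ 2 / 2

lemma gaussianReal_eq_withDensity (m : ℝ) {v : ℝ≥0} (hv : 0 < v) :
    gaussianReal m v
      = (gaussianReal 0 1).withDensity fun t => ENNReal.ofReal (Real.exp (logRatio m v t)) := by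
  have hv' : (0 : ℝ) < v := hv
  have hmeas : Measurable fun t => ENNReal.ofReal (Real.exp (logRatio m v t)) := by
    unfold logRatio; fun_prop
  rw [gaussianReal_of_var_ne_zero _ hv.ne', gaussianReal_of_var_ne_zero _ one_ne_zero,
    ← withDensity_mul _ (measurable_gaussianPDF 0 1) hmeas]
  congr 1
  ext t
  rw [Pi.mul_apply, gaussianPDF, gaussianPDF, ← ENNReal.ofReal_mul (gaussianPDFReal_nonneg _ _ _)]
  congr 1
  simp only [gaussianPDFReal, logRatio, NNReal.coe_one, mul_one, sub_zero]
  rw [Real.exp_add, Real.exp_sub, Real.exp_neg, Real.exp_half (Real.log v), Real.exp_log hv',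
    Real.sqrt_mul (x := 2 * Real.pi) (by positivity), mul_inv, neg_div, neg_div, Real.exp_neg,
    Real.exp_neg]
  field_simp

/-- The Kullback-Leibler divergence of a Gaussian from the standard Gaussian. -/
noncomputable def klGauss (m v : ℝ) : ℝ := (v + m ^ 2 - 1 - Real.log v) / 2

lemma integrable_logRatio (m : ℝ) (v : ℝ≥0) : Integrable (logRatio m v) (gaussianReal m v) := by
  have h2 : ∀ c : ℝ, Integrable (fun t : ℝ => (t - c) ^ 2) (gaussianReal m v) := fun c =>
    ((memLp_id_gaussianReal' 2 (by simp)).sub (memLp_const c)).integrable_sq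
  have h3 := h2 0
  simp only [sub_zero] at h3
  exact ((integrable_const _).sub ((h2 m).div_const _)).add (h3.div_const _)

lemma integral_logRatio (m : ℝ) {v : ℝ≥0} (hv : 0 < v) :
    ∫ t, logRatio m v t ∂gaussianReal m v = klGauss m v := by
  have hv' : (v : ℝ) ≠ 0 := by exact_mod_cast hv.ne'
  have h1 : Integrable (fun t : ℝ => (t - m) ^ 2) (gaussianReal m v) :=
    ((memLp_id_gaussianReal' 2 (by simp)).sub (memLp_const m)).integrable_sq
  have h0 : Integrable (fun t : ℝ => t) (gaussianReal m v) :=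
    (memLp_id_gaussianReal' 1 (by simp)).integrable le_rfl
  have hvar : ∫ t, (t - m) ^ 2 ∂gaussianReal m v = v := by
    have := variance_fun_id_gaussianReal (μ := m) (v := v)
    rw [variance_eq_integral (by fun_prop), integral_id_gaussianReal] at this
    exact this
  have hEq : ∀ t, logRatio m v t = ((1 / 2 - 1 / (2 * v)) * (t - m) ^ 2 + m * t)
      + (-(Real.log v / 2) - m ^ 2 / 2) := by
    intro t; unfold logRatio; ring
  simp only [hEq]
  have h2 : Integrable (fun t : ℝ => (1 / 2 - 1 / (2 * v)) * (t - m) ^ 2 + m * t)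
    (gaussianReal m v) := (h1.const_mul _).add (h0.const_mul _)
  rw [integral_add h2 (integrable_const _), integral_add (h1.const_mul _) (h0.const_mul _),
    integral_const_mul, integral_const_mul, hvar, integral_id_gaussianReal]
  simp only [integral_const, probReal_univ, smul_eq_mul, one_mul, klGauss]
  field_simp
  ring

/-- The log-density of a product is a sum of one-coordinate log-densities, so the divergence is
additive. -/
lemma toReal_klDiv_pi_gaussianReal (m : ι → ℝ) {v : ι → ℝ≥0} (hv : ∀ p, 0 < v p) :
    (klDiv (Measure.pi fun p => gaussianReal (m p) (v p))
      (Measure.pi fun _ : ι => gaussianReal 0 1)).toReal = ∑ p, klGauss (m p) (v p) := by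
  set Q := Measure.pi fun p => gaussianReal (m p) (v p) with hQ
  set P := Measure.pi fun _ : ι => gaussianReal 0 1 with hP
  have hmeas : ∀ p, Measurable fun t => ENNReal.ofReal (Real.exp (logRatio (m p) (v p) t)) := by
    intro p; unfold logRatio; fun_prop
  have hQP : Q = P.withDensity
      fun θ => ∏ p, ENNReal.ofReal (Real.exp (logRatio (m p) (v p) (θ p))) := by
    have : ∀ p, SigmaFinite ((gaussianReal 0 1).withDensity
        fun t => ENNReal.ofReal (Real.exp (logRatio (m p) (v p) t))) := fun p => by
      rw [← gaussianReal_eq_withDensity (m p) (hv p)]; infer_instance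
    rw [hP, ← pi_withDensity (fun _ : ι => gaussianReal 0 1) hmeas, hQ]
    congr 1
    ext1 p
    exact gaussianReal_eq_withDensity (m p) (hv p)
  have hac : Q ≪ P := by rw [hQP]; exact withDensity_absolutelyContinuous _ _
  rw [toReal_klDiv_of_measure_eq hac (by simp)]
  have hllr : llr Q P =ᵐ[Q] fun θ => ∑ p, logRatio (m p) (v p) (θ p) := by
    refine hac.ae_le ?_
    have hprod : Measurable fun θ : ι → ℝ =>
        ∏ p, ENNReal.ofReal (Real.exp (logRatio (m p) (v p) (θ p))) :=
      Finset.measurable_fun_prod _ fun p _ => (hmeas p).comp (measurable_pi_apply p)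
    have := Measure.rnDeriv_withDensity P hprod
    rw [← hQP] at this
    filter_upwards [this] with θ hθ
    rw [llr, hθ, ENNReal.toReal_prod]
    simp only [ENNReal.toReal_ofReal (Real.exp_pos _).le]
    rw [← Real.exp_sum, Real.log_exp]
  have hint : ∀ p, Integrable (fun θ : ι → ℝ => logRatio (m p) (v p) (θ p)) Q := fun p =>
    (measurePreserving_eval (fun p => gaussianReal (m p) (v p)) p).integrable_comp_of_integrable
      (integrable_logRatio (m p) (v p))
  rw [integral_congr_ae hllr, integral_finsetSum _ fun p _ => hint p]
  refine Finset.sum_congr rfl fun p _ => ?_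
  rw [← integral_logRatio (m p) (hv p),
    ← (measurePreserving_eval (fun p => gaussianReal (m p) (v p)) p).map_eq,
    integral_map (measurable_pi_apply p).aemeasurable (by unfold logRatio; fun_prop)]

/-- From `log s ≤ s - 1`. In terms of mean and standard deviation the divergence is thus coercive,
which bounds the search for an optimum. -/
lemma klGauss_lower (m : ℝ) {s : ℝ} (hs : 0 < s) :
    (m ^ 2 + (s - 1) ^ 2) / 2 ≤ klGauss m (s ^ 2) := by
  have := Real.log_le_sub_one_of_pos hs
  rw [klGauss, Real.log_pow]
  push_cast
  nlinarith

lemma klGauss_nonneg (m : ℝ) {v : ℝ} (hv : 0 < v) : 0 ≤ klGauss m v := by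
  have := Real.log_le_sub_one_of_pos hv
  rw [klGauss]
  nlinarith [sq_nonneg m]

end KullbackLeibler

/-! ### Reparametrization of the variational family by the prior -/

section FactorizedGaussian

variable {Din M H : ℕ}

instance (m : NNParam Din M H → ℝ) (v : NNParam Din M H → ℝ≥0) :
    IsProbabilityMeasure (factorizedGaussian m v) := by
  unfold factorizedGaussian; infer_instance

instance : IsProbabilityMeasure (nnPrior Din M H) := by
  unfold nnPrior; infer_instance

lemma measurable_affine (m s : NNParam Din M H → ℝ) :
    Measurable fun ξ : NNParam Din M H → ℝ => fun p => m p + s p * ξ p := by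
  fun_prop

/-- Factorized Gaussians are affine images of the prior. -/
lemma factorizedGaussian_eq_map (m : NNParam Din M H → ℝ) (v : NNParam Din M H → ℝ≥0) :
    factorizedGaussian m v
      = (nnPrior Din M H).map fun ξ p => m p + √(v p : ℝ) * ξ p := by
  unfold nnPrior factorizedGaussian
  rw [Measure.pi_map_pi (f := fun p t => m p + √(v p : ℝ) * t) fun p => by fun_prop]
  congr 1
  ext1 p
  have : (fun t => m p + √(v p : ℝ) * t) = (fun t => m p + t) ∘ fun t => √(v p : ℝ) * t := rfl
  rw [this, ← Measure.map_map (by fun_prop) (by fun_prop), gaussianReal_map_const_mul,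
    gaussianReal_map_const_add]
  congr 1
  · simp
  · ext
    simp

lemma PolyGrowth.integrable_factorizedGaussian {F : (NNParam Din M H → ℝ) → ℝ} (hF : PolyGrowth F)
    (m : NNParam Din M H → ℝ) (v : NNParam Din M H → ℝ≥0) :
    Integrable F (factorizedGaussian m v) := by
  rw [factorizedGaussian_eq_map, integrable_map_measure hF.continuous.aestronglyMeasurable
    (measurable_affine _ _).aemeasurable]
  exact (hF.comp_affine m fun p => √(v p : ℝ)).integrable

lemma PolyGrowth.integral_factorizedGaussian {F : (NNParam Din M H → ℝ) → ℝ} (hF : PolyGrowth F)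
    (m : NNParam Din M H → ℝ) (v : NNParam Din M H → ℝ≥0) :
    ∫ θ, F θ ∂factorizedGaussian m v
      = ∫ ξ, F (fun p => m p + √(v p : ℝ) * ξ p) ∂nnPrior Din M H := by
  rw [factorizedGaussian_eq_map, integral_map (measurable_affine _ _).aemeasurable
    hF.continuous.aestronglyMeasurable]

end FactorizedGaussian

/-! ### The evidence lower bound: existence and quality of optima -/

section EvidenceLowerBound

variable {Din M H N : ℕ} {φ : ℝ → ℝ} {K : ℝ} (x : Fin N → EuclideanSpace ℝ (Fin Din))
  (y : Fin N → ℝ)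

/-- The squared loss of the network on the data. -/
noncomputable def sqLoss (φ : ℝ → ℝ) (θ : NNParam Din M H → ℝ) : ℝ :=
  ∑ n, (y n - network φ θ (x n)) ^ 2

lemma sqLoss_nonneg (θ : NNParam Din M H → ℝ) : 0 ≤ sqLoss x y φ θ :=
  Finset.sum_nonneg fun _ _ => sq_nonneg _

lemma polyGrowth_sqLoss (hφ : Continuous φ) (h : ∀ t, φ t ^ 2 ≤ K * (1 + t ^ 2)) :
    PolyGrowth fun θ : NNParam Din M H → ℝ => sqLoss x y φ θ :=
  PolyGrowth.sum fun n =>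
    ((PolyGrowth.const (y n)).sub (polyGrowth_network (x n) hφ (abs_le_of_sq_le h))).pow 2

/-- The evidence lower bound of a factorized Gaussian in terms of the expected squared loss. -/
lemma elbo_factorizedGaussian (hφ : Continuous φ) (h : ∀ t, φ t ^ 2 ≤ K * (1 + t ^ 2)) {σ : ℝ≥0}
    (hσ : 0 < σ) (m : NNParam Din M H → ℝ) {v : NNParam Din M H → ℝ≥0} (hv : ∀ p, 0 < v p) :
    elbo φ x y σ (factorizedGaussian m v)
      = N * Real.log (√(2 * Real.pi * σ))⁻¹
        - (∫ θ, sqLoss x y φ θ ∂factorizedGaussian m v) / (2 * σ)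
        - ∑ p, klGauss (m p) (v p) := by
  have hσ' : (0 : ℝ) < σ := hσ
  have hlog : ∀ θ : NNParam Din M H → ℝ, logLikelihood φ x y σ θ
      = N * Real.log (√(2 * Real.pi * σ))⁻¹ - sqLoss x y φ θ / (2 * σ) := by
    intro θ
    simp only [logLikelihood, gaussianPDFReal, sqLoss, Finset.sum_div]
    have hc : (N : ℝ) * Real.log (√(2 * Real.pi * σ))⁻¹
        = ∑ _n : Fin N, Real.log (√(2 * Real.pi * σ))⁻¹ := by simp
    rw [hc, ← Finset.sum_sub_distrib]
    refine Finset.sum_congr rfl fun n _ => ?_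
    rw [Real.log_mul (by positivity) (Real.exp_pos _).ne', Real.log_exp]
    ring
  rw [elbo, show (InformationTheory.klDiv (factorizedGaussian m v) (nnPrior Din M H)).toReal
    = ∑ p, klGauss (m p) (v p) from toReal_klDiv_pi_gaussianReal m hv]
  congr 1
  simp only [hlog]
  rw [integral_sub (integrable_const _) (((polyGrowth_sqLoss x y hφ h).integrable_factorizedGaussian
    m v).div_const _), integral_div]
  simp

/-- For each width, an optimal mean-field posterior exists. -/
lemma exists_isOptimalMeanField (hφ : Continuous φ) (h : ∀ t, φ t ^ 2 ≤ K * (1 + t ^ 2))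
    {σ : ℝ≥0} (hσ : 0 < σ) :
    ∃ Q : Measure (NNParam Din M H → ℝ), IsOptimalMeanField φ x y σ Q := by
  have hσ' : (0 : ℝ) < σ := hσ
  set R : (NNParam Din M H → ℝ) × (NNParam Din M H → ℝ) → ℝ := fun q =>
    ∫ ξ, sqLoss x y φ (fun p => q.1 p + q.2 p * ξ p) ∂nnPrior Din M H with hR
  have hRc : Continuous R := (polyGrowth_sqLoss x y hφ h).continuous_integral_affine
  have hR0 : ∀ q, 0 ≤ R q := fun q => integral_nonneg fun _ => sqLoss_nonneg x y _
  set D : (NNParam Din M H → ℝ) × (NNParam Din M H → ℝ) → ℝ := fun q =>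
    ∑ p, klGauss (q.1 p) (q.2 p ^ 2) with hD
  set J := fun q => R q / (2 * σ) + D q with hJ
  have hJk : ∀ q, (∀ p, 0 < q.2 p) → ∀ p, klGauss (q.1 p) (q.2 p ^ 2) ≤ J q := by
    intro q hq p
    have h1 : klGauss (q.1 p) (q.2 p ^ 2) ≤ D q :=
      Finset.single_le_sum (f := fun p => klGauss (q.1 p) (q.2 p ^ 2))
        (fun p _ => klGauss_nonneg _ (pow_pos (hq p) 2)) (Finset.mem_univ p)
    have h2 : 0 ≤ R q / (2 * σ) := div_nonneg (hR0 q) (by positivity)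
    simp only [hJ]
    linarith
  set q₀ : (NNParam Din M H → ℝ) × (NNParam Din M H → ℝ) := (0, 1) with hq₀
  set B := J q₀ with hB
  have hB0 : 0 ≤ B := add_nonneg (div_nonneg (hR0 _) (by positivity))
    (Finset.sum_nonneg fun p _ => klGauss_nonneg _ (by simp [hq₀]))
  -- This box of means and standard deviations contains every point doing at least as well as the
  -- prior. The quadratic lower bound limits means and large deviations; the logarithm in the
  -- divergence keeps standard deviations above `exp (-(B + 1))`.
  set S : Set ((NNParam Din M H → ℝ) × (NNParam Din M H → ℝ)) :=
    Set.Icc (fun _ => -(1 + 2 * B)) (fun _ => 1 + 2 * B) ×ˢ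
      Set.Icc (fun _ => Real.exp (-(B + 1))) (fun _ => 2 + 2 * B) with hS
  have hScomp : IsCompact S := isCompact_Icc.prod isCompact_Icc
  have hSpos : ∀ q ∈ S, ∀ p, 0 < q.2 p := fun q hq p => (Real.exp_pos _).trans_le (hq.2.1 p)
  have hq₀S : q₀ ∈ S := by
    refine ⟨⟨fun p => ?_, fun p => ?_⟩, ⟨fun p => ?_, fun p => ?_⟩⟩ <;>
      simp only [hq₀, Pi.zero_apply, Pi.one_apply]
    · linarith
    · linarith
    · exact Real.exp_le_one_iff.2 (by linarith)
    · linarith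
  have hmemS : ∀ q, (∀ p, 0 < q.2 p) → J q ≤ B → q ∈ S := by
    intro q hq hqB
    have hk : ∀ p, klGauss (q.1 p) (q.2 p ^ 2) ≤ B := fun p => (hJk q hq p).trans hqB
    have hl : ∀ p, ((q.1 p) ^ 2 + (q.2 p - 1) ^ 2) / 2 ≤ B := fun p =>
      (klGauss_lower _ (hq p)).trans (hk p)
    refine ⟨⟨fun p => ?_, fun p => ?_⟩, ⟨fun p => ?_, fun p => ?_⟩⟩
    · simp only; nlinarith [hl p, sq_nonneg (q.2 p - 1), sq_nonneg (q.1 p + 1)]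
    · simp only; nlinarith [hl p, sq_nonneg (q.2 p - 1), sq_nonneg (q.1 p - 1)]
    · have := hk p
      rw [klGauss, Real.log_pow] at this
      push_cast at this
      refine (Real.le_log_iff_exp_le (hq p)).1 ?_
      nlinarith [sq_nonneg (q.1 p), sq_nonneg (q.2 p)]
    · simp only; nlinarith [hl p, sq_nonneg (q.1 p), sq_nonneg (q.2 p - 2)]
  have hJc : ContinuousOn J S := by
    refine ((hRc.div_const _).continuousOn).add
      (continuousOn_finsetSum _ fun p _ => ?_)
    unfold klGauss
    refine ContinuousOn.div_const (ContinuousOn.sub (by fun_prop) ?_) _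
    exact ContinuousOn.log (by fun_prop) fun q hq => (pow_pos (hSpos q hq p) 2).ne'
  obtain ⟨q, hqS, hq⟩ := hScomp.exists_isMinOn ⟨q₀, hq₀S⟩ hJc
  have hqpos := hSpos q hqS
  have helbo : ∀ (m : NNParam Din M H → ℝ) (v : NNParam Din M H → ℝ≥0), (∀ p, 0 < v p) →
      elbo φ x y σ (factorizedGaussian m v)
        = N * Real.log (√(2 * Real.pi * σ))⁻¹ - J (m, fun p => √(v p : ℝ)) := by
    intro m v hv
    rw [elbo_factorizedGaussian x y hφ h hσ m hv,
      (polyGrowth_sqLoss x y hφ h).integral_factorizedGaussian]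
    simp only [hJ, hR, hD, Real.sq_sqrt (NNReal.coe_nonneg _)]
    ring
  have hglob : ∀ q', (∀ p, 0 < q'.2 p) → J q ≤ J q' := by
    intro q' hq'
    rcases le_or_gt (J q') B with h' | h'
    · exact hq (hmemS q' hq' h')
    · exact (hq hq₀S).trans h'.le
  have hvpos : ∀ p, 0 < (q.2 p ^ 2).toNNReal := fun p => Real.toNNReal_pos.2 (pow_pos (hqpos p) 2)
  refine ⟨factorizedGaussian q.1 fun p => (q.2 p ^ 2).toNNReal, ⟨_, _, hvpos, rfl⟩, ?_⟩
  rintro _ ⟨m, v, hv, rfl⟩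
  simp only [Set.mem_ofPred_eq]
  rw [helbo m v hv, helbo _ _ hvpos]
  have e : (fun p => √(((q.2 p ^ 2).toNNReal : ℝ≥0) : ℝ)) = q.2 := by
    ext p
    rw [Real.coe_toNNReal _ (sq_nonneg _), Real.sqrt_sq (hqpos p).le]
  rw [e]
  have := hglob (m, fun p => √(v p : ℝ)) fun p => Real.sqrt_pos.2 (by exact_mod_cast hv p)
  linarith

/-- The expected squared loss of an optimal posterior is controlled by any other member of the
variational family. -/
lemma IsOptimalMeanField.integral_sqLoss_le (hφ : Continuous φ)
    (h : ∀ t, φ t ^ 2 ≤ K * (1 + t ^ 2)) {σ : ℝ≥0} (hσ : 0 < σ)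
    {Q : Measure (NNParam Din M H → ℝ)} (hQ : IsOptimalMeanField φ x y σ Q)
    (m : NNParam Din M H → ℝ) {v : NNParam Din M H → ℝ≥0} (hv : ∀ p, 0 < v p) :
    ∫ θ, sqLoss x y φ θ ∂Q ≤ ∫ θ, sqLoss x y φ θ ∂factorizedGaussian m v
      + 2 * σ * ∑ p, klGauss (m p) (v p) := by
  have hσ' : (0 : ℝ) < σ := hσ
  obtain ⟨⟨m', v', hv', rfl⟩, hmax⟩ := hQ
  have := hmax (show factorizedGaussian m v ∈ meanFieldFamily Din M H from ⟨m, v, hv, rfl⟩)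
  simp only [Set.mem_ofPred_eq] at this
  rw [elbo_factorizedGaussian x y hφ h hσ m hv, elbo_factorizedGaussian x y hφ h hσ m' hv'] at this
  -- The divergence of the optimum itself is nonnegative and can be dropped.
  have hkl : 0 ≤ ∑ p, klGauss (m' p) (v' p) :=
    Finset.sum_nonneg fun p _ => klGauss_nonneg _ (by exact_mod_cast hv' p)
  have h1 : (∫ θ, sqLoss x y φ θ ∂factorizedGaussian m' v') / (2 * σ)
      ≤ (∫ θ, sqLoss x y φ θ ∂factorizedGaussian m v) / (2 * σ) + ∑ p, klGauss (m p) (v p) := by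
    linarith
  rw [div_le_iff₀ (by positivity)] at h1
  refine h1.trans (le_of_eq ?_)
  field_simp

/-- The squared error of the predictive mean is at most the expected squared loss. -/
lemma sum_sq_sub_predictiveMean_le (hφ : Continuous φ) (h : ∀ t, φ t ^ 2 ≤ K * (1 + t ^ 2))
    {Q : Measure (NNParam Din M H → ℝ)} (hQ : Q ∈ meanFieldFamily Din M H) :
    ∑ n, (y n - predictiveMean φ Q (x n)) ^ 2 ≤ ∫ θ, sqLoss x y φ θ ∂Q := by
  obtain ⟨m, v, -, rfl⟩ := hQ
  unfold sqLoss
  have hg : ∀ n, PolyGrowth fun θ : NNParam Din M H → ℝ => network φ θ (x n) := fun n =>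
    polyGrowth_network (x n) hφ (abs_le_of_sq_le h)
  have hr : ∀ n, PolyGrowth fun θ : NNParam Din M H → ℝ => (y n - network φ θ (x n)) ^ 2 :=
    fun n => ((PolyGrowth.const (y n)).sub (hg n)).pow 2
  rw [integral_finsetSum _ fun n _ => (hr n).integrable_factorizedGaussian m v]
  refine Finset.sum_le_sum fun n _ => ?_
  set Q := factorizedGaussian m v
  set e := y n - predictiveMean φ Q (x n) with he
  have hi := (hg n).integrable_factorizedGaussian m v
  -- Jensen's inequality: the integrand is the tangent line of the square at the mean residual `e`.
  have hm : ∫ θ, (e ^ 2 + 2 * e * ((y n - network φ θ (x n)) - e)) ∂Q = e ^ 2 := by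
    have h1 : Integrable (fun θ => y n - network φ θ (x n)) Q := (integrable_const _).sub hi
    have h2 : Integrable (fun θ => (y n - network φ θ (x n)) - e) Q := h1.sub (integrable_const _)
    rw [integral_add (integrable_const _) (h2.const_mul _), integral_const_mul,
      integral_sub h1 (integrable_const _), integral_sub (integrable_const _) hi]
    simp [he, predictiveMean, Q]
  rw [← hm]
  have h1 : Integrable (fun θ => y n - network φ θ (x n)) Q := (integrable_const _).sub hi
  refine integral_mono ((integrable_const _).add ((h1.sub (integrable_const _)).const_mul _))
    ((hr n).integrable_factorizedGaussian m v) fun θ => ?_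
  simp only
  nlinarith [sq_nonneg ((y n - network φ θ (x n)) - e)]

end EvidenceLowerBound

/-! ### Interpolation at a fixed width -/

section ExactFit

variable {Din M H : ℕ} {φ : ℝ → ℝ} {K : ℝ}

/-- The parameters of a network whose neurons all compute the same affine function of the
activations of the previous layer, and of the first input coordinate. -/
noncomputable def replicatedParam (i₀ : Fin Din) (M H : ℕ) (a b α β γ δ : ℝ) :
    NNParam Din M H → ℝ
  | .weightIn _ j => if j = i₀ then a * √Din else 0
  | .biasIn _ => b
  | .weightHid _ _ _ => α / √M
  | .biasHid _ _ => β
  | .weightOut _ => γ / √M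
  | .biasOut => δ

lemma inv_sqrt_mul_sum_div_sqrt (hM : 1 ≤ M) (α t : ℝ) :
    1 / √(M : ℝ) * ∑ _j : Fin M, α / √(M : ℝ) * t = α * t := by
  have hM0 : (0 : ℝ) < M := by exact_mod_cast hM
  simp only [Finset.sum_const, Finset.card_univ, Fintype.card_fin, nsmul_eq_mul]
  have h : √(M : ℝ) * √(M : ℝ) = M := Real.mul_self_sqrt hM0.le
  have h0 : √(M : ℝ) ≠ 0 := (Real.sqrt_pos.2 hM0).ne'
  field_simp
  rw [sq, h]

/-- By `h1`, `p` is a fixed point of the map from one layer to the next, so the value `p` created in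
the first layer persists at any depth. -/
lemma preact_replicatedParam (hDin : 1 ≤ Din) (hM : 1 ≤ M) (i₀ : Fin Din) {a b α β γ δ r p : ℝ}
    (h0 : a * r + b = p) (h1 : α * φ p + β = p) {l : ℕ} (hl : l ≤ H) (i : Fin M) :
    preact φ (replicatedParam i₀ M H a b α β γ δ) (EuclideanSpace.single i₀ r) l hl i = p := by
  have hD0 : (0 : ℝ) < Din := by exact_mod_cast hDin
  induction l generalizing i with
  | zero =>
    have : √(Din : ℝ) ≠ 0 := (Real.sqrt_pos.2 hD0).ne'
    simp only [preact, replicatedParam, PiLp.single_apply, mul_ite, mul_zero, ite_mul, zero_mul,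
      Finset.sum_ite_eq', Finset.mem_univ, if_true]
    rw [← h0]
    field_simp
  | succ l ih =>
    simp only [preact, replicatedParam, ih]
    rw [inv_sqrt_mul_sum_div_sqrt hM, h1]

lemma network_replicatedParam (hDin : 1 ≤ Din) (hM : 1 ≤ M) (i₀ : Fin Din)
    {a b α β γ δ r p : ℝ} (h0 : a * r + b = p) (h1 : α * φ p + β = p) :
    network φ (replicatedParam i₀ M H a b α β γ δ) (EuclideanSpace.single i₀ r)
      = γ * φ p + δ := by
  simp only [network, preact_replicatedParam hDin hM i₀ h0 h1, replicatedParam]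
  rw [inv_sqrt_mul_sum_div_sqrt hM]

/-- A network of any width can interpolate two points with distinct first input coordinates. -/
lemma exists_network_eq (hDin : 1 ≤ Din) (hM : 1 ≤ M) (H : ℕ) {p q : ℝ} (hpq : φ p ≠ φ q)
    (i₀ : Fin Din) {r : Fin 2 → ℝ} (hr : r 0 ≠ r 1) (y : Fin 2 → ℝ) :
    ∃ θ : NNParam Din M H → ℝ, ∀ n, network φ θ (EuclideanSpace.single i₀ (r n)) = y n := by
  have hr' : r 0 - r 1 ≠ 0 := sub_ne_zero.2 hr
  have hφ' : φ p - φ q ≠ 0 := sub_ne_zero.2 hpq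
  -- Slopes of the affine maps sending `r 0, r 1` to `p, q`, then `φ p, φ q` back to `p, q`, and
  -- finally `φ p, φ q` to `y 0, y 1`.
  set a := (p - q) / (r 0 - r 1) with ha
  set α := (p - q) / (φ p - φ q) with hα
  set γ := (y 0 - y 1) / (φ p - φ q) with hγ
  have ea : a * (r 0 - r 1) = p - q := div_mul_cancel₀ _ hr'
  have eα : α * (φ p - φ q) = p - q := div_mul_cancel₀ _ hφ'
  have eγ : γ * (φ p - φ q) = y 0 - y 1 := div_mul_cancel₀ _ hφ'
  refine ⟨replicatedParam i₀ M H a (p - a * r 0) α (p - α * φ p) γ (y 0 - γ * φ p), fun n => ?_⟩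
  fin_cases n
  · simp only [Fin.zero_eta]
    rw [network_replicatedParam (p := p) hDin hM i₀ (by ring) (by ring)]
    ring
  · simp only [Fin.mk_one]
    rw [network_replicatedParam (p := q) hDin hM i₀ (by linarith) (by linarith)]
    linarith

/-- For a fixed width, factorized Gaussians concentrated around interpolating parameters have
arbitrarily small expected squared loss. -/
lemma exists_integral_sqLoss_le {N : ℕ} (x : Fin N → EuclideanSpace ℝ (Fin Din)) (y : Fin N → ℝ)
    (hφ : Continuous φ) (h : ∀ t, φ t ^ 2 ≤ K * (1 + t ^ 2)) {θ₀ : NNParam Din M H → ℝ}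
    (hθ₀ : ∀ n, network φ θ₀ (x n) = y n) {ε : ℝ} (hε : 0 < ε) :
    ∃ (m : NNParam Din M H → ℝ) (v : NNParam Din M H → ℝ≥0), (∀ p, 0 < v p) ∧
      ∫ θ, sqLoss x y φ θ ∂factorizedGaussian m v ≤ ε := by
  have hg : PolyGrowth fun θ : NNParam Din M H → ℝ => sqLoss x y φ θ := polyGrowth_sqLoss x y hφ h
  set R : ℝ → ℝ := fun t =>
    ∫ ξ, sqLoss x y φ (fun p => θ₀ p + t * ξ p) ∂nnPrior Din M H with hR
  have hRc : Continuous R := by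
    have := hg.continuous_integral_affine.comp
      (f := fun t : ℝ => (θ₀, fun _ : NNParam Din M H => t)) (by fun_prop)
    exact this
  have hR0 : R 0 = 0 := by simp [hR, sqLoss, hθ₀]
  -- The point mass `t = 0` has zero loss but lies outside the family; continuity of the loss
  -- provides a positive standard deviation.
  have hev : ∀ᶠ t in nhdsWithin (0 : ℝ) (Set.Ioi 0), R t < ε :=
    nhdsWithin_le_nhds (hRc.continuousAt.eventually_lt_const (by rwa [hR0]))
  obtain ⟨t, htε, ht⟩ := (hev.and self_mem_nhdsWithin).exists
  have ht0 : 0 < t := ht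
  refine ⟨θ₀, fun _ => (t ^ 2).toNNReal, fun _ => Real.toNNReal_pos.2 (by positivity), ?_⟩
  rw [hg.integral_factorizedGaussian]
  simp only [Real.coe_toNNReal _ (sq_nonneg t), Real.sqrt_sq ht0.le]
  exact htε.le

end ExactFit

/-! ### Shifting the output weights, and a fit uniform in the width -/

section WideNetwork

variable {Din M H : ℕ} {φ : ℝ → ℝ} {K : ℝ}

/-- The parameters with all output weights equal to `a / √M` and all others zero. -/
noncomputable def outputShift (Din M H : ℕ) (a : ℝ) : NNParam Din M H → ℝ
  | .weightOut _ => a / √M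
  | _ => 0

/-- Output weights do not affect hidden layers, and the factors `1 / √M` of the shift and of the
network combine into an empirical mean. -/
lemma network_outputShift_add (hM : 1 ≤ M) (a : ℝ) (ξ : NNParam Din M H → ℝ)
    (x : EuclideanSpace ℝ (Fin Din)) :
    network φ (fun p => outputShift Din M H a p + ξ p) x
      = network φ ξ x + a * (1 / (M : ℝ) * ∑ i, φ (preact φ ξ x H le_rfl i)) := by
  have hM0 : (0 : ℝ) < M := by exact_mod_cast hM
  have hpre : ∀ i, preact φ (fun p => outputShift Din M H a p + ξ p) x H le_rfl i
      = preact φ ξ x H le_rfl i := fun i => preact_congr x le_rfl (fun p hp => by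
    cases p <;> simp [outputShift, NNParam.layer] at hp ⊢) i
  have h0 : √(M : ℝ) ≠ 0 := (Real.sqrt_pos.2 hM0).ne'
  rw [network, network]
  simp only [hpre]
  simp only [outputShift, zero_add, add_mul, Finset.sum_add_distrib,
    ← Finset.mul_sum]
  have h : 1 / √(M : ℝ) * (a / √(M : ℝ)) = a * (1 / M) := by
    rw [div_mul_div_comm, Real.mul_self_sqrt hM0.le]; ring
  linear_combination (∑ i, φ (preact φ ξ x H le_rfl i)) * h

/-- Each of the `M` output weights costs `a ^ 2 / (2 * M)`; the total is independent of the width,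
which is what lets the shift survive as `M → ∞`. -/
lemma sum_klGauss_outputShift (hM : 1 ≤ M) (a : ℝ) :
    ∑ p, klGauss (outputShift Din M H a p) 1 = a ^ 2 / 2 := by
  have hM0 : (0 : ℝ) < M := by exact_mod_cast hM
  rw [NNParam.sum_eq]
  simp only [outputShift, klGauss, div_pow, Real.sq_sqrt hM0.le]
  simp only [Finset.sum_const, Finset.card_univ, Fintype.card_fin, nsmul_eq_mul, Real.log_one]
  field_simp
  ring

/-- The expected squared loss of the prior with shifted output weights. -/
lemma integral_sqLoss_outputShift_le (hM : 1 ≤ M) (hφ : Continuous φ)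
    (h : ∀ t, φ t ^ 2 ≤ K * (1 + t ^ 2)) {N : ℕ} (x : Fin N → EuclideanSpace ℝ (Fin Din))
    (g : Fin N → ℝ) (a : ℝ) :
    ∫ θ, sqLoss x (fun n => a * g n) φ θ ∂factorizedGaussian (outputShift Din M H a) (fun _ => 1)
      ≤ ∑ n, (2 * a ^ 2 * ∫ ξ, (1 / (M : ℝ) * ∑ i, φ (preact φ ξ (x n) H le_rfl i) - g n) ^ 2
          ∂nnPrior Din M H + 2 * ∫ ξ, network φ ξ (x n) ^ 2 ∂nnPrior Din M H) := by
  rw [(polyGrowth_sqLoss x _ hφ h).integral_factorizedGaussian]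
  simp only [NNReal.coe_one, Real.sqrt_one, one_mul, sqLoss, network_outputShift_add hM]
  have hφK := abs_le_of_sq_le h
  have hA : ∀ n, Integrable (fun ξ => (1 / (M : ℝ) * ∑ i, φ (preact φ ξ (x n) H le_rfl i)
      - g n) ^ 2) (nnPrior Din M H) := fun n =>
    ((((PolyGrowth.sum fun i => (polyGrowth_preact (x n) hφ hφK le_rfl i).comp_sq_le hφ
      hφK).const_mul _).sub (.const _)).pow 2).integrable
  have hf : ∀ n, Integrable (fun ξ => network φ ξ (x n) ^ 2) (nnPrior Din M H) := fun n =>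
    ((polyGrowth_network (x n) hφ hφK).pow 2).integrable
  have hsum : ∀ n, Integrable (fun ξ => 2 * a ^ 2 * (1 / (M : ℝ) *
      ∑ i, φ (preact φ ξ (x n) H le_rfl i) - g n) ^ 2 + 2 * network φ ξ (x n) ^ 2)
      (nnPrior Din M H) := fun n => ((hA n).const_mul _).add ((hf n).const_mul _)
  calc _ ≤ ∫ ξ, ∑ n, (2 * a ^ 2 * (1 / (M : ℝ) *
        ∑ i, φ (preact φ ξ (x n) H le_rfl i) - g n) ^ 2 + 2 * network φ ξ (x n) ^ 2)
          ∂nnPrior Din M H := by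
        refine integral_mono_of_nonneg
          (ae_of_all _ fun ξ => Finset.sum_nonneg fun n _ => sq_nonneg _)
          (integrable_finsetSum _ fun n _ => hsum n)
          (ae_of_all _ fun ξ => Finset.sum_le_sum fun n _ => ?_)
        set A := 1 / (M : ℝ) * ∑ i, φ (preact φ ξ (x n) H le_rfl i)
        nlinarith [sq_nonneg (a * (g n - A) + network φ ξ (x n))]
    _ = _ := by
        rw [integral_finsetSum _ fun n _ => hsum n]
        refine Finset.sum_congr rfl fun n _ => ?_
        rw [integral_add ((hA n).const_mul _) ((hf n).const_mul _), integral_const_mul,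
          integral_const_mul]

/-- A uniform bound over the widths is obtained from a bound for large widths and bounds for each
width. -/
lemma exists_bound_of_eventually {p : ℕ → ℝ → Prop} (hmono : ∀ M b b', b ≤ b' → p M b → p M b')
    {B₀ : ℝ} {M₀ : ℕ} (hlarge : ∀ M, M₀ ≤ M → p M B₀) (hsmall : ∀ M, ∃ b, p M b) :
    ∃ B, 0 ≤ B ∧ ∀ M, p M B := by
  choose b hb using hsmall
  have hnn : 0 ≤ ∑ M ∈ Finset.range M₀, |b M| := Finset.sum_nonneg fun _ _ => abs_nonneg _
  refine ⟨|B₀| + ∑ M ∈ Finset.range M₀, |b M|, by positivity, fun M => ?_⟩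
  rcases le_or_gt M₀ M with h | h
  · exact hmono _ _ _ (by linarith [le_abs_self B₀]) (hlarge M h)
  · refine hmono _ _ _ ?_ (hb M)
    have := Finset.single_le_sum (f := fun M => |b M|) (fun _ _ => abs_nonneg _)
      (Finset.mem_range.2 h)
    linarith [le_abs_self (b M), abs_nonneg B₀]

/-- For two inputs at which the limiting mean activations of the last layer differ, there are
targets, as far apart as `a * |g 0 - g 1|`, that some mean-field distributions fit uniformly in the
width at bounded Kullback-Leibler divergence from the prior. -/
lemma exists_uniform_fit (hDin : 1 ≤ Din) (hφ : Continuous φ)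
    (h : ∀ t, φ t ^ 2 ≤ K * (1 + t ^ 2)) (H : ℕ) {p q : ℝ} (hpq : φ p ≠ φ q) (i₀ : Fin Din)
    {r : Fin 2 → ℝ} (hr : r 0 ≠ r 1) {g : Fin 2 → ℝ}
    (hg : ∀ n, g n = gaussMean φ (layerVar φ (inputVar (EuclideanSpace.single i₀ (r n))) H))
    (hd : g 0 ≠ g 1) :
    ∃ a B : ℝ, 0 < a ∧ 0 ≤ B ∧ ∀ M : ℕ, 1 ≤ M →
      ∃ (m : NNParam Din M H → ℝ) (v : NNParam Din M H → ℝ≥0), (∀ p, 0 < v p) ∧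
        ∫ θ, sqLoss (fun n => EuclideanSpace.single i₀ (r n)) (fun n => a * g n) φ θ
          ∂factorizedGaussian m v ≤ (a * (g 0 - g 1)) ^ 2 / 16 ∧
        ∑ p, klGauss (m p) (v p) ≤ B := by
  set x : Fin 2 → EuclideanSpace ℝ (Fin Din) := fun n => EuclideanSpace.single i₀ (r n) with hx
  choose C hC using fun n => exists_integral_sq_average_sub_le (x n) hDin hφ h H
  choose C' hC' using fun n => exists_integral_sq_network_le (x n) hDin hφ h H
  set E := |C 0| + |C 1| with hE
  set E' := |C' 0| + |C' 1| with hE'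
  have hE0 : 0 ≤ E := by positivity
  have hE'0 : 0 ≤ E' := by positivity
  have hd0 : 0 < |g 0 - g 1| := abs_pos.2 (sub_ne_zero.2 hd)
  -- With this `a` the allowed loss is `4 * (1 + E') ^ 2`, which exceeds `1 + 2 * E'`: the prior
  -- output contributes at most `2 * E'`, and the concentration error at most `1` once `M ≥ 2 * a ^
  -- 2 * E`.
  set a := 8 * (1 + E') / |g 0 - g 1| with ha
  have ha0 : 0 < a := by positivity
  have had : (a * (g 0 - g 1)) ^ 2 = 64 * (1 + E') ^ 2 := by
    rw [mul_pow, ← sq_abs (g 0 - g 1), ← mul_pow, ha, div_mul_cancel₀ _ hd0.ne']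
    ring
  have hε : 0 < (a * (g 0 - g 1)) ^ 2 / 16 := by rw [had]; positivity
  obtain ⟨M₀, hM₀⟩ := exists_nat_ge (2 * a ^ 2 * E)
  have hlarge : ∀ M : ℕ, M₀ ≤ M → 1 ≤ M →
      ∃ (m : NNParam Din M H → ℝ) (v : NNParam Din M H → ℝ≥0), (∀ p, 0 < v p) ∧
        ∫ θ, sqLoss x (fun n => a * g n) φ θ ∂factorizedGaussian m v
          ≤ (a * (g 0 - g 1)) ^ 2 / 16 ∧
        ∑ p, klGauss (m p) (v p) ≤ a ^ 2 / 2 := by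
    intro M hMM hM
    have hM1 : (0 : ℝ) < M := by exact_mod_cast hM
    refine ⟨outputShift Din M H a, fun _ => 1, fun _ => one_pos, ?_,
      (by simpa using (sum_klGauss_outputShift hM a).le)⟩
    refine (integral_sqLoss_outputShift_le hM hφ h x g a).trans ?_
    rw [Fin.sum_univ_two, had]
    have h1 : ∀ n, ∫ ξ, (1 / (M : ℝ) * ∑ i, φ (preact φ ξ (x n) H le_rfl i) - g n) ^ 2
        ∂nnPrior Din M H ≤ |C n| / M := fun n => by
      rw [hg n]
      exact (hC n M hM).trans (div_le_div_of_nonneg_right (le_abs_self _) hM1.le)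
    have h2 : ∀ n, ∫ ξ, network φ ξ (x n) ^ 2 ∂nnPrior Din M H ≤ |C' n| := fun n =>
      (hC' n M hM).trans (le_abs_self _)
    have h3 : 2 * a ^ 2 * (|C 0| / M) + 2 * a ^ 2 * (|C 1| / M) ≤ 1 := by
      have : 2 * a ^ 2 * (|C 0| / M) + 2 * a ^ 2 * (|C 1| / M) = 2 * a ^ 2 * E / M := by
        rw [hE]; ring
      rw [this, div_le_one hM1]
      exact hM₀.trans (by exact_mod_cast hMM)
    have h4 : ∀ n, 2 * a ^ 2 * ∫ ξ, (1 / (M : ℝ) * ∑ i, φ (preact φ ξ (x n) H le_rfl i) - g n) ^ 2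
        ∂nnPrior Din M H ≤ 2 * a ^ 2 * (|C n| / M) := fun n =>
      mul_le_mul_of_nonneg_left (h1 n) (by positivity)
    nlinarith [h4 0, h4 1, h2 0, h2 1]
  -- Below `M₀` no concentration is available; the divergence of an almost exact fit serves as the
  -- bound, one for each width.
  have hsmall : ∀ M : ℕ, ∃ b : ℝ, 1 ≤ M →
      ∃ (m : NNParam Din M H → ℝ) (v : NNParam Din M H → ℝ≥0), (∀ p, 0 < v p) ∧
        ∫ θ, sqLoss x (fun n => a * g n) φ θ ∂factorizedGaussian m v
          ≤ (a * (g 0 - g 1)) ^ 2 / 16 ∧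
        ∑ p, klGauss (m p) (v p) ≤ b := by
    intro M
    by_cases hM : 1 ≤ M
    · obtain ⟨θ₀, hθ₀⟩ := exists_network_eq hDin hM H hpq i₀ hr (fun n => a * g n)
      obtain ⟨m, v, hv, hle⟩ := exists_integral_sqLoss_le x (fun n => a * g n) hφ h hθ₀ hε
      exact ⟨_, fun _ => ⟨m, v, hv, hle, le_rfl⟩⟩
    · exact ⟨0, fun hM' => absurd hM' hM⟩
  obtain ⟨B, hB0, hB⟩ := exists_bound_of_eventually (p := fun M b => 1 ≤ M →
      ∃ (m : NNParam Din M H → ℝ) (v : NNParam Din M H → ℝ≥0), (∀ p, 0 < v p) ∧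
        ∫ θ, sqLoss x (fun n => a * g n) φ θ ∂factorizedGaussian m v
          ≤ (a * (g 0 - g 1)) ^ 2 / 16 ∧
        ∑ p, klGauss (m p) (v p) ≤ b)
    (fun M b b' hb hp hM => by
      obtain ⟨m, v, hv, h1, h2⟩ := hp hM
      exact ⟨m, v, hv, h1, h2.trans hb⟩) hlarge hsmall
  exact ⟨a, B, ha0, hB0, hB⟩

lemma exists_inputVar_single_eq (hDin : 1 ≤ Din) (i₀ : Fin Din) {v : ℝ} (hv : 1 ≤ v) :
    ∃ r : ℝ, inputVar (EuclideanSpace.single i₀ r) = v := by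
  have hD0 : (0 : ℝ) < Din := by exact_mod_cast hDin
  refine ⟨√((v - 1) * Din), ?_⟩
  have hnn : 0 ≤ (v - 1) * Din := mul_nonneg (by linarith) hD0.le
  simp only [inputVar, PiLp.single_apply, ite_pow, Real.sq_sqrt hnn]
  simp only [ne_eq, OfNat.ofNat_ne_zero, not_false_eq_true, zero_pow, Finset.sum_ite_eq',
    Finset.mem_univ, if_true]
  field_simp
  ring

end WideNetwork

/-! ### The main theorem -/

theorem theorem4 (φ : ℝ → ℝ) (hcont : Continuous φ)
    (hlin : ∃ K : ℝ, ∀ a, |φ a| ≤ K * (|a| + 1))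
    (heven : ∃ a a' : ℝ, evenPart φ a ≠ evenPart φ a')
    (hsq : ∃ a : ℝ, φ a ^ 2 + φ (-a) ^ 2 ≠ 2 * φ 0 ^ 2)
    (Din H : ℕ) (hDin : 1 ≤ Din) :
    ∃ (x : Fin 2 → EuclideanSpace ℝ (Fin Din)) (y : Fin 2 → ℝ) (s : ℝ≥0) (c : ℝ),
      0 < s ∧ 0 < c ∧
      ∀ M : ℕ, 1 ≤ M →
        (∃ Q : Measure (NNParam Din M H → ℝ), IsOptimalMeanField φ x y s Q) ∧
        ∀ Q : Measure (NNParam Din M H → ℝ), IsOptimalMeanField φ x y s Q →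
          c ≤ |predictiveMean φ Q (x 0) - predictiveMean φ Q (x 1)| ∧
          c / 2 ≤ max
            |predictiveMean φ Q (x 0) - predictiveMean φ (nnPrior Din M H) (x 0)|
            |predictiveMean φ Q (x 1) - predictiveMean φ (nnPrior Din M H) (x 1)| := by
  obtain ⟨K, hK⟩ := hlin
  have hgrow : ∀ t, φ t ^ 2 ≤ 2 * K ^ 2 * (1 + t ^ 2) := fun t => by
    have h1 : φ t ^ 2 ≤ (K * (|t| + 1)) ^ 2 := by
      rw [← sq_abs (φ t)]
      exact pow_le_pow_left₀ (abs_nonneg _) (hK t) 2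
    have h2 : (|t| + 1) ^ 2 ≤ 2 * (1 + t ^ 2) := by
      nlinarith [sq_nonneg (|t| - 1), sq_abs t]
    nlinarith [sq_nonneg K]
  obtain ⟨p, q, hpq⟩ : ∃ p q, φ p ≠ φ q := by
    by_contra! hcon
    obtain ⟨a, a', ha⟩ := heven
    exact ha (by simp only [evenPart]; rw [hcon a a', hcon (-a) (-a')])
  have i₀ : Fin Din := ⟨0, hDin⟩
  obtain ⟨v, w, hv, hw, hne⟩ := exists_gaussMean_layerVar_ne hcont hgrow heven hsq H
  obtain ⟨r, hr⟩ := exists_inputVar_single_eq hDin i₀ hv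
  obtain ⟨r', hr'⟩ := exists_inputVar_single_eq hDin i₀ hw
  have hrr : r ≠ r' := by
    rintro rfl
    exact hne (by rw [← hr, ← hr'])
  set ρ : Fin 2 → ℝ := ![r, r'] with hρ
  set g : Fin 2 → ℝ := fun n =>
    gaussMean φ (layerVar φ (inputVar (EuclideanSpace.single i₀ (ρ n))) H) with hg
  have hd : g 0 ≠ g 1 := by simpa [hg, hρ, hr, hr'] using hne
  obtain ⟨a, B, ha, hB, hfit⟩ := exists_uniform_fit hDin hcont hgrow H hpq i₀ (r := ρ)
    (by simpa [hρ] using hrr) (g := g) (fun n => rfl) hd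
  set Δ := a * (g 0 - g 1) with hΔ
  have hΔ0 : 0 < |Δ| := abs_pos.2 (mul_ne_zero ha.ne' (sub_ne_zero.2 hd))
  have hΔ2 : 0 < Δ ^ 2 := by rw [← sq_abs]; positivity
  set x : Fin 2 → EuclideanSpace ℝ (Fin Din) := fun n => EuclideanSpace.single i₀ (ρ n) with hx
  set y : Fin 2 → ℝ := fun n => a * g n with hy
  -- The noise variance is chosen so that the divergence penalty `2 * σ * B` is at most `Δ ^ 2 /
  -- 16`, like the loss of the competitor; `B + 1` avoids division by zero.
  have hσ0 : 0 < Δ ^ 2 / 32 / (B + 1) := by positivity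
  set σ : ℝ≥0 := (Δ ^ 2 / 32 / (B + 1)).toNNReal with hσ
  have hσpos : 0 < σ := Real.toNNReal_pos.2 hσ0
  have hσB : 2 * σ * B ≤ Δ ^ 2 / 16 := by
    rw [hσ, Real.coe_toNNReal _ hσ0.le]
    have : 2 * (Δ ^ 2 / 32 / (B + 1)) * B = Δ ^ 2 / 16 * (B / (B + 1)) := by ring
    rw [this]
    exact mul_le_of_le_one_right (by positivity) ((div_le_one (by positivity)).2 (by linarith))
  refine ⟨x, y, σ, |Δ| / 2, hσpos, by positivity, fun M hM =>
    ⟨exists_isOptimalMeanField x y hcont hgrow hσpos, fun Q hQ => ?_⟩⟩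
  obtain ⟨m, u, hu, hrisk, hkl⟩ := hfit M hM
  have h1 := hQ.integral_sqLoss_le x y hcont hgrow hσpos m hu
  have h2 := sum_sq_sub_predictiveMean_le x y hcont hgrow hQ.1
  have h3 : 2 * σ * ∑ p, klGauss (m p) (u p) ≤ 2 * σ * B :=
    mul_le_mul_of_nonneg_left hkl (by positivity)
  set μ₀ := predictiveMean φ Q (x 0)
  set μ₁ := predictiveMean φ Q (x 1)
  rw [Fin.sum_univ_two] at h2
  have h4 : (y 0 - μ₀) ^ 2 + (y 1 - μ₁) ^ 2 ≤ Δ ^ 2 / 8 := by linarith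
  have hyΔ : y 0 - y 1 = Δ := by simp only [hy, hΔ]; ring
  -- The squared difference of the two residuals is at most twice the sum of their squares, hence at
  -- most `Δ ^ 2 / 4`.
  have h5 : (Δ - (μ₀ - μ₁)) ^ 2 ≤ (|Δ| / 2) ^ 2 := by
    rw [div_pow, sq_abs, ← hyΔ]
    rw [← hyΔ] at h4
    nlinarith [sq_nonneg ((y 0 - μ₀) + (y 1 - μ₁))]
  have h6 : |Δ - (μ₀ - μ₁)| ≤ |Δ| / 2 := abs_le_of_sq_le_sq h5 (by positivity)
  have h7 : |Δ| / 2 ≤ |μ₀ - μ₁| := by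
    have := abs_sub_abs_le_abs_sub Δ (μ₀ - μ₁)
    linarith
  refine ⟨h7, ?_⟩
  -- The prior mean is zero at both inputs, so the separation of the two posterior means forces one
  -- of them away from it.
  rw [predictiveMean_nnPrior (x 0) hM hcont hgrow, predictiveMean_nnPrior (x 1) hM hcont hgrow,
    sub_zero, sub_zero]
  have h8 : |μ₀ - μ₁| ≤ |μ₀| + |μ₁| := abs_sub _ _
  have h9 := le_max_left |μ₀| |μ₁|
  have h10 := le_max_right |μ₀| |μ₁|
  linarith
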